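/- Let $n,m\ge 1$, let $1<s\le\infty$ with conjugate exponent $s'$ ($\frac1s+\frac1{s'}=1$), let $1\le s'<p_i<\infty$ for $i=1,\dots,m$, put $\vec P=(p_1,\dots,p_m)$ and $\frac1p=\sum_{i=1}^m\frac1{p_i}$. Then there is a constant $C=C(n,m,\vec P,s)<\infty$ with the following property. All cubes $Q\subset\mathbb R^n$ have sides parallel to the axes, and $\langle g\rangle_Q=\frac1{|Q|}\int_Q g$. Let $\vec\omega=(\omega_1,\dots,\omega_m)$ be nonnegative measurable functions on $\mathbb R^n$, let $\nu_{\vec\omega}=\prod_{i=1}^m\omega_i^{p/p_i}$ and $\sigma_i=\omega_i^{1-(p_i/s')'}$, where $r'=\frac r{r-1}$, and assume $\vec\omega\in A_{\vec P/s'}$, that is, $$[\vec\omega]_{A_{\vec P/s'}}=\sup_Q\ \langle\nu_{\vec\omega}\rangle_Q\prod_{i=1}^m\langle\sigma_i\rangle_Q^{\frac{p/s'}{(p_i/s')'}}<\infty .$$ For a weight $\sigma$ let $[\sigma]_{A_\infty}=\sup_Q\frac1{\sigma(Q)}\int_Q M(\sigma 1_Q)$, where $\sigma(Q)=\int_Q\sigma$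 and $M$ is the Hardy–Littlewood maximal operator over cubes. Let $\vec f=(f_1,\dots,f_m)$ be measurable functions on $\mathbb R^n$, and for $\Omega:(\mathbb R^n)^m\to\mathbb C$ let $$\mathcal M_\Omega(\vec f)(x)=\sup_{Q\ni x}\frac1{|Q|^m}\int_{Q^m}|\Omega(x-y_1,\dots,x-y_m)|\prod_{i=1}^m|f_i(y_i)|\,d\vec y .$$ (a) If $\Omega(\lambda y_1,\dots,\lambda y_m)=\Omega(y_1,\dots,y_m)$ for all $\lambda>0$ and all $y_1,\dots,y_m\in\mathbb R^n$, and $\Omega\in L^s(S^{mn-1})$, where $S^{mn-1}$ is the unit sphere of $(\mathbb R^n)^m=\mathbb R^{mn}$ with its surface measure, then $$\|\mathcal M_\Omega(\vec f)\|_{L^p(\nu_{\vec\omega})}\le C\,\|\Omega\|_{L^s(S^{mn-1})}\,[\vec\omega]_{A_{\vec P/s'}}^{1/p}\ \prod_{i=1}^m[\sigma_i]_{A_\infty}^{1/p_i}\ \prod_{i=1}^m\|f_i\|_{L^{p_i}(\omega_i)} .$$ (b) If $\Omega$ is homogeneous of degree zero in each variable, that is, $\Omega(\lambda_1y_1,\dots,\lambda_my_m)=\Omega(y_1,\dots,y_m)$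 for all $\lambda_1,\dots,\lambda_m>0$ and all $y_1,\dots,y_m\in\mathbb R^n$, and $\Omega\in L^s((S^{n-1})^m)$ with respect to the product of the surface measures, then the same inequality holds with $\|\Omega\|_{L^s((S^{n-1})^m)}$ in place of $\|\Omega\|_{L^s(S^{mn-1})}$. (Both inequalities are between elements of $[0,\infty]$, with $0\cdot\infty=0$.) -/

import Mathlib

open MeasureTheory
open scoped ENNReal NNReal

noncomputable section

/-- A (closed) cube in `ℝⁿ` with sides parallel to the axes and positive side length. -/
def IsCube {n : ℕ} (Q : Set (EuclideanSpace ℝ (Fin n))) : Prop :=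
  ∃ (a : EuclideanSpace ℝ (Fin n)) (l : ℝ), 0 < l ∧
    Q = {x | ∀ j, a j ≤ x j ∧ x j ≤ a j + l}

/-- The average `|Q|⁻¹ ∫_Q g` of a nonnegative function `g` over `Q`. -/
def cubeAvg {n : ℕ} (Q : Set (EuclideanSpace ℝ (Fin n)))
    (g : EuclideanSpace ℝ (Fin n) → ℝ≥0∞) : ℝ≥0∞ :=
  (volume Q)⁻¹ * ∫⁻ y in Q, g y

/-- The Hardy–Littlewood maximal function of `g ≥ 0`: the supremum of the averages of `g` over
all cubes containing the point. -/
def hlMaximal {n : ℕ} (g : EuclideanSpace ℝ (Fin n) → ℝ≥0∞) (x : EuclideanSpace ℝ (Fin n)) :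
    ℝ≥0∞ :=
  ⨆ (Q : Set (EuclideanSpace ℝ (Fin n))) (_ : IsCube Q) (_ : x ∈ Q), cubeAvg Q g

/-- The `A_∞` constant (Fujii–Wilson) of a weight `σ`:
the supremum over all cubes `Q` of `σ(Q)⁻¹ ∫_Q M(σ 1_Q)`. -/
def aInftyConst {n : ℕ} (σ : EuclideanSpace ℝ (Fin n) → ℝ≥0∞) : ℝ≥0∞ :=
  ⨆ (Q : Set (EuclideanSpace ℝ (Fin n))) (_ : IsCube Q),
    (∫⁻ x in Q, hlMaximal (Q.indicator σ) x) / ∫⁻ x in Q, σ x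

/-- The weight `ν_ω = ∏ ω_i ^ (p / p_i)`. -/
def jointWeight {n m : ℕ} (p : ℝ) (P : Fin m → ℝ)
    (ω : Fin m → EuclideanSpace ℝ (Fin n) → ℝ≥0) (x : EuclideanSpace ℝ (Fin n)) : ℝ≥0∞ :=
  ∏ i, (ω i x : ℝ≥0∞) ^ (p / P i)

/-- The dual weight `w ^ (1 - r')`, `r' = r / (r - 1)`. It is computed in `[0, ∞]`, so for `r > 1`
it is `∞` where `w = 0`. -/
def dualWeight {n : ℕ} (r : ℝ) (w : EuclideanSpace ℝ (Fin n) → ℝ≥0)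
    (x : EuclideanSpace ℝ (Fin n)) : ℝ≥0∞ :=
  (w x : ℝ≥0∞) ^ (1 - Real.conjExponent r)

/-- The multilinear `A_P` constant, where `P = (p_1, …, p_m)` and `1/p = ∑ 1/p_i`:
the supremum over all cubes `Q` of
`∏ (⨍_Q ω_i ^ (1 - p_i')) ^ (p / p_i') * ⨍_Q ν_ω`. -/
def apConst {n m : ℕ} (p : ℝ) (P : Fin m → ℝ)
    (ω : Fin m → EuclideanSpace ℝ (Fin n) → ℝ≥0) : ℝ≥0∞ :=
  ⨆ (Q : Set (EuclideanSpace ℝ (Fin n))) (_ : IsCube Q),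
    (∏ i, cubeAvg Q (dualWeight (P i) (ω i)) ^ (p / Real.conjExponent (P i))) *
      cubeAvg Q (jointWeight p P ω)

/-- The multilinear maximal operator with rough kernel `Ω`:
`M_Ω(f)(x) = sup_{Q ∋ x} |Q|^{-m} ∫_{Q^m} |Ω(x - y_1, …, x - y_m)| ∏ |f_i(y_i)| dy`. -/
def roughMaximal {n m : ℕ} (Ω : (Fin m → EuclideanSpace ℝ (Fin n)) → ℂ)
    (f : Fin m → EuclideanSpace ℝ (Fin n) → ℂ) (x : EuclideanSpace ℝ (Fin n)) : ℝ≥0∞ :=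
  ⨆ (Q : Set (EuclideanSpace ℝ (Fin n))) (_ : IsCube Q) (_ : x ∈ Q),
    (volume Q ^ m)⁻¹ *
      ∫⁻ y in Set.univ.pi (fun _ : Fin m => Q), ‖Ω (fun i => x - y i)‖ₑ * ∏ i, ‖f i (y i)‖ₑ

/-- `‖g‖_{L^r(w)} = (∫ |g|^r w) ^ (1/r)` for `0 < r < ∞`, with respect to Lebesgue measure. -/
def weightedNorm {n : ℕ} {F : Type*} [ENorm F] (g : EuclideanSpace ℝ (Fin n) → F) (r : ℝ)
    (w : EuclideanSpace ℝ (Fin n) → ℝ≥0∞) : ℝ≥0∞ :=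
  eLpNorm g (ENNReal.ofReal r) (volume.withDensity w)

/-- The restriction of `Ω` to the unit sphere `S^{mn-1}` of `(ℝⁿ)^m = ℝ^{mn}`. -/
def restrictSphere {n m : ℕ} (Ω : (Fin m → EuclideanSpace ℝ (Fin n)) → ℂ)
    (θ : Metric.sphere (0 : PiLp 2 (fun _ : Fin m => EuclideanSpace ℝ (Fin n))) 1) : ℂ :=
  Ω (fun i => θ.1 i)

/-- The surface measure of `S^{mn-1}`. -/
def sphereMeasure (n m : ℕ) :
    Measure (Metric.sphere (0 : PiLp 2 (fun _ : Fin m => EuclideanSpace ℝ (Fin n))) 1) :=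
  (volume : Measure (PiLp 2 (fun _ : Fin m => EuclideanSpace ℝ (Fin n)))).toSphere

/-- The restriction of `Ω` to the product of unit spheres `(S^{n-1})^m`. -/
def restrictSpheres {n m : ℕ} (Ω : (Fin m → EuclideanSpace ℝ (Fin n)) → ℂ)
    (θ : Fin m → Metric.sphere (0 : EuclideanSpace ℝ (Fin n)) 1) : ℂ :=
  Ω (fun i => (θ i).1)

/-- The product of the surface measures of the factors on `(S^{n-1})^m`. -/
def spheresMeasure (n m : ℕ) :
    Measure (Fin m → Metric.sphere (0 : EuclideanSpace ℝ (Fin n)) 1) :=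
  Measure.pi (fun _ => (volume : Measure (EuclideanSpace ℝ (Fin n))).toSphere)

end

/-! On a cube `Q` containing `x`, Hölder's inequality with exponents `s`, `s'` separates the kernel
from the functions. The points `x - y_i` stay in a ball of radius comparable to the side of `Q`, so
by homogeneity the `L^s` norm of the kernel is at most a constant times `|Q|^{m/s} ‖Ω‖`. Hence
`M_Ω(f)` is pointwise at most `C ‖Ω‖ M(|f_1|^{s'}, …, |f_m|^{s'})^{1/s'}`, where `M(g)` is the
supremum of the products of averages of the `g_i` (`HasBallBound.cube_average_le`). It remains to
bound `M` in the mixed `A_P`-`A_∞` form with exponents `r_i = p_i/s'`, `q = p/s'`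
(`exists_multilinearMaximal_majorant`).

By the one-third trick, `M` is controlled by finitely many dyadic maximal functions, and by monotone
convergence by finite families of cells. In such a family, principal cells are selected so that the
product of averages grows by more than `2^m` from each one to any smaller one. This makes them
sparse, and `∫ M(g)^q dν` is at most a constant times the sum of `(∏⟨g_i⟩_Q)^q ν(Q)` over them.

Writing `g_i = h_i σ_i`, the `A_P` condition turns each term into a product of powers of `σ_i(Q)
(⟨h_i⟩_Q^{σ_i})^{r_i}`. Since `∑ q/r_i = 1`, Hölder for sums separates the indices, and the Carleson
embedding theorem bounds each factor by `∫ h_i^{r_i} dσ_i = ∫ g_i^{r_i} ω_i`. Its packing condition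
is where `A_∞` enters: by sparseness, the `σ_i(Q)` with `Q ⊆ R` sum to at most `2 ∫_R M(σ_i 1_R)`,
with `M` here the Hardy–Littlewood operator. -/

/-! ### Principal elements and inequalities for finite sums. -/

/-- Every finite family in a partial order contains a subfamily of principal elements for `A`. -/
theorem exists_principal_subfamily {ι : Type*} [PartialOrder ι] [DecidableEq ι] (A : ι → ℝ≥0∞)
    {a : ℝ≥0∞} (ha : 1 ≤ a) (F : Finset ι) :
    ∃ S ⊆ F, (∀ Q ∈ S, ∀ R ∈ S, Q < R → a * A R < A Q) ∧
      ∀ Q ∈ F, ∃ R ∈ S, Q ≤ R ∧ A Q ≤ a * A R := by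
  induction F using Finset.strongInduction with
  | H F ih =>
    rcases F.eq_empty_or_nonempty with rfl | hne
    · exact ⟨∅, by simp⟩
    obtain ⟨Q, hQ⟩ := F.exists_minimal hne
    obtain ⟨S, hSF, h1, h2⟩ := ih (F.erase Q) (Finset.erase_ssubset hQ.1)
    -- `Q` is minimal, so no selected element lies strictly below it. It is added exactly when no
    -- selected element above it already controls it.
    by_cases hc : ∃ R ∈ S, Q ≤ R ∧ A Q ≤ a * A R
    · refine ⟨S, hSF.trans (Finset.erase_subset _ _), h1, fun R hR => ?_⟩
      by_cases hRQ : R = Q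
      · exact hRQ ▸ hc
      · exact h2 R (Finset.mem_erase.2 ⟨hRQ, hR⟩)
    · push Not at hc
      refine ⟨insert Q S, ?_, ?_, fun R hR => ?_⟩
      · intro R hR
        rcases Finset.mem_insert.1 hR with rfl | h
        · exact hQ.1
        · exact Finset.mem_of_mem_erase (hSF h)
      · intro R hR T hT hRT
        rcases Finset.mem_insert.1 hR with rfl | hR'
        · rcases Finset.mem_insert.1 hT with rfl | hT'
          · exact absurd hRT (lt_irrefl _)
          · exact hc T hT' hRT.le
        · rcases Finset.mem_insert.1 hT with rfl | hT'
          · have := hQ.2 (Finset.mem_of_mem_erase (hSF hR')) hRT.le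
            exact absurd this (not_le_of_gt hRT)
          · exact h1 R hR' T hT' hRT
      · by_cases hRQ : R = Q
        · exact ⟨Q, Finset.mem_insert_self _ _, hRQ.le, hRQ ▸ le_mul_of_one_le_left' ha⟩
        · obtain ⟨T, hT, h⟩ := h2 R (Finset.mem_erase.2 ⟨hRQ, hR⟩)
          exact ⟨T, Finset.mem_insert_of_mem hT, h⟩

/-- Hölder's inequality for finite sums of products of finitely many families. -/
theorem sum_prod_rpow_le_prod_sum_rpow {ι κ : Type*} (S : Finset κ) (I : Finset ι)
    (f : ι → κ → ℝ≥0∞) {p : ι → ℝ} (hp : ∑ i ∈ I, p i = 1) (hp0 : ∀ i ∈ I, 0 ≤ p i) :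
    ∑ j ∈ S, ∏ i ∈ I, f i j ^ p i ≤ ∏ i ∈ I, (∑ j ∈ S, f i j) ^ p i := by
  let _ : MeasurableSpace S := ⊤
  have := ENNReal.lintegral_prod_norm_pow_le (μ := (Measure.count : Measure S)) I
    (f := fun i j => f i j) (fun i _ => (measurable_from_top).aemeasurable) hp hp0
  simp only [lintegral_count, tsum_fintype] at this
  rw [← Finset.sum_coe_sort S]
  simp_rw [← Finset.sum_coe_sort S (fun j => f _ j)]
  exact this

/-- A finite family growing geometrically is dominated by its largest member. -/
theorem sum_le_mul_sup_of_geometric {ι : Type*} [DecidableEq ι] {ρ C : ℝ≥0∞} (hρ : ρ ≠ 0)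
    (hρ' : ρ ≠ ∞) (hC : 1 + ρ⁻¹ * C ≤ C) (b : ι → ℝ≥0∞) (T : Finset ι)
    (h : ∀ Q ∈ T, ∀ R ∈ T, Q ≠ R → ρ * b Q ≤ b R ∨ ρ * b R ≤ b Q) :
    ∑ Q ∈ T, b Q ≤ C * T.sup b := by
  induction T using Finset.strongInduction with
  | H T ih =>
    rcases T.eq_empty_or_nonempty with rfl | hne
    · simp
    obtain ⟨M, hM, hmax⟩ := T.exists_max_image b hne
    -- All other members are at most `ρ⁻¹ * b M`. After peeling off the largest one, the induction
    -- closes because `1 + ρ⁻¹ * C ≤ C`.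
    have h2 : (T.erase M).sup b ≤ ρ⁻¹ * b M := by
      refine Finset.sup_le fun R hR => ?_
      have hRT := Finset.mem_of_mem_erase hR
      rw [mul_comm, ← div_eq_mul_inv, ENNReal.le_div_iff_mul_le (Or.inl hρ) (Or.inl hρ'), mul_comm]
      rcases h R hRT M hM (Finset.ne_of_mem_erase hR) with h' | h'
      · exact h'
      · calc ρ * b R ≤ ρ * b M := by gcongr; exact hmax R hRT
          _ ≤ b R := h'
          _ ≤ b M := hmax R hRT
    have h3 := ih (T.erase M) (Finset.erase_ssubset hM)
      (fun Q hQ R hR => h Q (Finset.mem_of_mem_erase hQ) R (Finset.mem_of_mem_erase hR))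
    calc ∑ Q ∈ T, b Q = b M + ∑ Q ∈ T.erase M, b Q := (Finset.add_sum_erase T b hM).symm
      _ ≤ b M + C * (ρ⁻¹ * b M) := by gcongr; exact h3.trans (by gcongr)
      _ = (1 + ρ⁻¹ * C) * b M := by ring
      _ ≤ C * T.sup b := by gcongr; exact Finset.le_sup hM

/-! ### Laminar families and sparseness. -/

/-- Any two members of the family are nested or disjoint. -/
def IsLaminar {X : Type*} (F : Finset (Set X)) : Prop :=
  ∀ Q ∈ F, ∀ R ∈ F, Q ⊆ R ∨ R ⊆ Q ∨ Disjoint Q R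

theorem IsLaminar.mono {X : Type*} {F S : Finset (Set X)} (hF : IsLaminar F) (h : S ⊆ F) :
    IsLaminar S := fun Q hQ R hR => hF Q (h hQ) R (h hR)

open Classical in
/-- The part of `Q` not covered by the strictly smaller members of `S`. -/
def ownPart {X : Type*} (S : Finset (Set X)) (Q : Set X) : Set X :=
  Q \ ⋃ R ∈ S.filter (· ⊂ Q), R

theorem disjoint_ownPart {X : Type*} {S : Finset (Set X)} (hS : IsLaminar S) {Q R : Set X} (hQ : Q ∈ S)
    (hR : R ∈ S) (hne : Q ≠ R) : Disjoint (ownPart S Q) (ownPart S R) := by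
  classical
  have key : ∀ Q ∈ S, ∀ R : Set X, Q ⊂ R → Disjoint (ownPart S Q) (ownPart S R) := by
    intro Q hQ R h
    refine Set.disjoint_left.2 fun x hx hx' => hx'.2 ?_
    exact Set.mem_biUnion (Finset.mem_coe.2 (Finset.mem_filter.2 ⟨hQ, h⟩)) hx.1
  rcases hS Q hQ R hR with h | h | h
  · exact key Q hQ R (h.ssubset_of_ne hne)
  · exact (key R hR Q (h.ssubset_of_ne hne.symm)).symm
  · exact h.mono Set.sdiff_subset Set.sdiff_subset

section
variable {X : Type*} [MeasurableSpace X]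

theorem measurableSet_ownPart {S : Finset (Set X)} (hS : ∀ Q ∈ S, MeasurableSet Q) {Q : Set X}
    (hQ : Q ∈ S) : MeasurableSet (ownPart S Q) := by
  classical
  exact
  (hS Q hQ).diff (Finset.measurableSet_biUnion _ fun R hR => hS R (Finset.mem_filter.1 hR).1)

/-- The product of the averages of the measures `φ i` over `Q` with respect to `μ`. -/
noncomputable def avgProd {m : ℕ} (μ : Measure X) (φ : Fin m → Measure X) (Q : Set X) : ℝ≥0∞ :=
  (∏ i, φ i Q) / μ Q ^ m

/-- A multilinear weak-type estimate. With `Φ = ∏ φ i`, the `m`-th root of the growth condition is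
`2 μ(Q) Φ(R)^{1/m} ≤ μ(R) Φ(Q)^{1/m}`. The maximal members of `S` are disjoint and cover the union,
and Hölder with `m` exponents `1/m` bounds the sum of their `Φ(Q)^{1/m}` by `Φ(R)^{1/m}`, which then
cancels. -/
theorem measure_biUnion_le_of_avgProd_growth {m : ℕ} (hm : 0 < m) {μ : Measure X}
    {φ : Fin m → Measure X} {S : Finset (Set X)} (hSl : IsLaminar S)
    (hSm : ∀ Q ∈ S, MeasurableSet Q) (hS0 : ∀ Q ∈ S, μ Q ≠ 0) (hST : ∀ Q ∈ S, μ Q ≠ ∞)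
    {R : Set X} (hR : μ R ≠ 0) (hRT : μ R ≠ ∞) (hQR : ∀ Q ∈ S, Q ⊆ R)
    (h : ∀ Q ∈ S, 2 ^ m * avgProd μ φ R < avgProd μ φ Q) :
    2 * μ (⋃ Q ∈ S, Q) ≤ μ R := by
  classical
  rcases S.eq_empty_or_nonempty with rfl | ⟨Q₀, hQ₀⟩
  · simp
  have hmR : (0 : ℝ) < 1 / m := by positivity
  set Φ : Set X → ℝ≥0∞ := fun Q => ∏ i, φ i Q with hΦ
  -- The strict growth at a single member excludes both `Φ R = 0` and `Φ R = ∞`, which permits the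
  -- final cancellation.
  have hΦR0 : Φ R ≠ 0 := by
    intro h0
    have h1 : Φ Q₀ = 0 := le_antisymm
      (h0 ▸ Finset.prod_le_prod' fun i _ => measure_mono (hQR Q₀ hQ₀)) zero_le
    have h2 := h Q₀ hQ₀
    simp only [avgProd] at h2
    rw [show (∏ i, φ i Q₀) = 0 from h1] at h2
    simp at h2
  have hΦRT : Φ R ≠ ∞ := by
    intro h0
    have h2 := h Q₀ hQ₀
    simp only [avgProd] at h2
    rw [show (∏ i, φ i R) = ∞ from h0, ENNReal.top_div_of_ne_top (ENNReal.pow_ne_top hRT),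
      ENNReal.mul_top (by positivity)] at h2
    simp at h2
  have hpt : ∀ Q ∈ S, 2 * μ Q * Φ R ^ (1 / (m : ℝ)) ≤ μ R * Φ Q ^ (1 / (m : ℝ)) := by
    intro Q hQ
    have h1 : (2 * μ Q) ^ m * Φ R ≤ μ R ^ m * Φ Q := by
      have h2 := (h Q hQ).le
      simp only [avgProd] at h2
      rw [ENNReal.le_div_iff_mul_le (Or.inl (pow_ne_zero _ (hS0 Q hQ)))
        (Or.inl (ENNReal.pow_ne_top (hST Q hQ)))] at h2
      calc (2 * μ Q) ^ m * Φ R = μ R ^ m * (2 ^ m * (Φ R / μ R ^ m) * μ Q ^ m) := by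
            rw [mul_pow]
            conv_lhs => rw [← ENNReal.div_mul_cancel (a := μ R ^ m) (b := Φ R) (pow_ne_zero _ hR)
              (ENNReal.pow_ne_top hRT)]
            ring
        _ ≤ μ R ^ m * Φ Q := by gcongr
    have h3 := ENNReal.rpow_le_rpow h1 hmR.le
    rw [ENNReal.mul_rpow_of_nonneg _ _ hmR.le, ENNReal.mul_rpow_of_nonneg _ _ hmR.le] at h3
    simpa only [one_div, ENNReal.pow_rpow_inv_natCast hm.ne'] using h3
  set T := S.filter (fun Q => ∀ Q' ∈ S, Q ⊆ Q' → Q' = Q) with hT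
  have hTS : T ⊆ S := Finset.filter_subset _ _
  have hcover : (⋃ Q ∈ S, Q) ⊆ ⋃ Q ∈ T, Q := by
    intro x hx
    simp only [Set.mem_iUnion, exists_prop] at hx ⊢
    obtain ⟨Q, hQ, hxQ⟩ := hx
    obtain ⟨Q', hQQ', hmax⟩ := S.exists_le_maximal hQ
    exact ⟨Q', Finset.mem_filter.2 ⟨hmax.1, fun Q'' h1 h2 => (hmax.2 h1 h2).antisymm h2⟩,
      hQQ' hxQ⟩
  have hdisj : (T : Set (Set X)).PairwiseDisjoint id := by
    intro Q hQ Q' hQ' hne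
    have hQ1 := Finset.mem_filter.1 (Finset.mem_coe.1 hQ)
    have hQ2 := Finset.mem_filter.1 (Finset.mem_coe.1 hQ')
    rcases hSl Q hQ1.1 Q' hQ2.1 with h | h | h
    · exact absurd (hQ1.2 Q' hQ2.1 h).symm hne
    · exact absurd (hQ2.2 Q hQ1.1 h) hne
    · exact h
  have hsumφ : ∀ i, ∑ Q ∈ T, φ i Q ≤ φ i R := by
    intro i
    have := measure_biUnion_finset (μ := φ i) (f := id) hdisj (fun Q hQ => hSm Q (hTS hQ))
    simp only [id] at this
    rw [← this]
    exact measure_mono (Set.iUnion₂_subset fun Q hQ => hQR Q (hTS hQ))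
  have hG0 : Φ R ^ (1 / (m : ℝ)) ≠ 0 := by simp [ENNReal.rpow_eq_zero_iff, hΦR0, hΦRT]
  have hGT : Φ R ^ (1 / (m : ℝ)) ≠ ∞ := ENNReal.rpow_ne_top_of_nonneg hmR.le hΦRT
  have hmain : 2 * μ (⋃ Q ∈ S, Q) * Φ R ^ (1 / (m : ℝ)) ≤ μ R * Φ R ^ (1 / (m : ℝ)) := by
    calc 2 * μ (⋃ Q ∈ S, Q) * Φ R ^ (1 / (m : ℝ))
        ≤ 2 * (∑ Q ∈ T, μ Q) * Φ R ^ (1 / (m : ℝ)) := by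
          gcongr
          exact (measure_mono hcover).trans (measure_biUnion_finset_le _ _)
      _ = ∑ Q ∈ T, 2 * μ Q * Φ R ^ (1 / (m : ℝ)) := by
          rw [Finset.mul_sum, Finset.sum_mul]
      _ ≤ ∑ Q ∈ T, μ R * Φ Q ^ (1 / (m : ℝ)) := Finset.sum_le_sum fun Q hQ => hpt Q (hTS hQ)
      _ = μ R * ∑ Q ∈ T, ∏ i, φ i Q ^ (1 / (m : ℝ)) := by
          rw [Finset.mul_sum]
          simp_rw [ENNReal.prod_rpow_of_nonneg hmR.le]
          rfl
      _ ≤ μ R * ∏ i, (∑ Q ∈ T, φ i Q) ^ (1 / (m : ℝ)) := by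
          gcongr
          refine sum_prod_rpow_le_prod_sum_rpow T Finset.univ (fun i Q => φ i Q) ?_
            (fun _ _ => hmR.le)
          simp [hm.ne']
      _ ≤ μ R * ∏ i, (φ i R) ^ (1 / (m : ℝ)) := by
          gcongr with i
          exact hsumφ i
      _ = μ R * Φ R ^ (1 / (m : ℝ)) := by rw [ENNReal.prod_rpow_of_nonneg hmR.le]
  exact (ENNReal.mul_le_mul_iff_left hG0 hGT).1 hmain

/-- Sparseness: the strictly smaller principal sets cover at most half of `R`. -/
theorem measure_le_two_mul_ownPart {m : ℕ} (hm : 0 < m) {μ : Measure X}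
    {φ : Fin m → Measure X} {S : Finset (Set X)} (hSl : IsLaminar S)
    (hSm : ∀ Q ∈ S, MeasurableSet Q) (hS0 : ∀ Q ∈ S, μ Q ≠ 0) (hST : ∀ Q ∈ S, μ Q ≠ ∞)
    (h : ∀ Q ∈ S, ∀ R ∈ S, Q < R → 2 ^ m * avgProd μ φ R < avgProd μ φ Q)
    {R : Set X} (hR : R ∈ S) : μ R ≤ 2 * μ (ownPart S R) := by
  classical
  set S' := S.filter (· ⊂ R) with hS'
  have hsub : S' ⊆ S := Finset.filter_subset _ _
  have h1 := measure_biUnion_le_of_avgProd_growth hm (μ := μ) (φ := φ) (hSl.mono hsub)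
    (fun Q hQ => hSm Q (hsub hQ)) (fun Q hQ => hS0 Q (hsub hQ)) (fun Q hQ => hST Q (hsub hQ))
    (hS0 R hR) (hST R hR) (fun Q hQ => (Finset.mem_filter.1 hQ).2.subset)
    (fun Q hQ => h Q (hsub hQ) R hR (Finset.mem_filter.1 hQ).2)
  have h2 : μ R ≤ μ (⋃ Q ∈ S', Q) + μ (ownPart S R) := by
    have : R ⊆ (⋃ Q ∈ S', Q) ∪ ownPart S R := by
      intro x hx
      by_cases hx' : x ∈ ⋃ Q ∈ S', Q
      · exact Or.inl hx'
      · exact Or.inr ⟨hx, hx'⟩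
    exact (measure_mono this).trans (measure_union_le _ _)
  have h3 : 2 * μ R ≤ μ R + 2 * μ (ownPart S R) := by
    calc 2 * μ R ≤ 2 * (μ (⋃ Q ∈ S', Q) + μ (ownPart S R)) := by gcongr
      _ = 2 * μ (⋃ Q ∈ S', Q) + 2 * μ (ownPart S R) := by ring
      _ ≤ _ := by gcongr
  rw [two_mul] at h3
  exact (ENNReal.add_le_add_iff_left (hST R hR)).1 h3

open Classical in
-- Produces the packing condition, with `g` standing for a maximal function of `σ`. Sparseness
-- allows `σ Q` to be charged to the average of `σ` times the own part of `Q`; that average is at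
-- most `g` there, and the own parts are disjoint.
theorem sum_measure_le_two_mul_lintegral {μ σ : Measure X} {S : Finset (Set X)}
    (hSl : IsLaminar S) (hSm : ∀ Q ∈ S, MeasurableSet Q) (hS0 : ∀ Q ∈ S, μ Q ≠ 0)
    (hST : ∀ Q ∈ S, μ Q ≠ ∞) (hres : ∀ Q ∈ S, μ Q ≤ 2 * μ (ownPart S Q)) {R : Set X}
    {g : X → ℝ≥0∞} (hg : ∀ Q ∈ S, Q ⊆ R → ∀ x ∈ Q, σ Q / μ Q ≤ g x) :
    ∑ Q ∈ S.filter (· ⊆ R), σ Q ≤ 2 * ∫⁻ x in R, g x ∂μ := by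
  set S' := S.filter (· ⊆ R)
  have hsub : ∀ Q ∈ S', Q ∈ S := fun Q hQ => (Finset.mem_filter.1 hQ).1
  calc ∑ Q ∈ S', σ Q ≤ ∑ Q ∈ S', 2 * ∫⁻ x in ownPart S Q, g x ∂μ := by
        refine Finset.sum_le_sum fun Q hQ => ?_
        have hQS := hsub Q hQ
        calc σ Q = σ Q / μ Q * μ Q := (ENNReal.div_mul_cancel (hS0 Q hQS) (hST Q hQS)).symm
          _ ≤ σ Q / μ Q * (2 * μ (ownPart S Q)) := by gcongr; exact hres Q hQS
          _ = 2 * ∫⁻ x in ownPart S Q, σ Q / μ Q ∂μ := by rw [setLIntegral_const]; ring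
          _ ≤ 2 * ∫⁻ x in ownPart S Q, g x ∂μ := by
            refine mul_le_mul_right ?_ _
            exact setLIntegral_mono' (measurableSet_ownPart hSm hQS)
              fun x hx => hg Q hQS (Finset.mem_filter.1 hQ).2 x hx.1
    _ = 2 * ∫⁻ x in ⋃ Q ∈ S', ownPart S Q, g x ∂μ := by
        rw [← Finset.mul_sum, lintegral_biUnion_finset]
        · intro Q hQ R hR hne
          exact disjoint_ownPart hSl (hsub Q hQ) (hsub R hR) hne
        · exact fun Q hQ => measurableSet_ownPart hSm (hsub Q hQ)
    _ ≤ 2 * ∫⁻ x in R, g x ∂μ := by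
        gcongr
        exact Set.iUnion₂_subset fun Q hQ =>
          Set.sdiff_subset.trans (Finset.mem_filter.1 hQ).2
-- The Carleson embedding theorem.
-- With `ρ = 2^(r-1)`, the witness `ρ/(ρ-1)` is the sum of the geometric series of ratio `1/ρ`, for
-- which equality holds.
theorem exists_geometric_const {r : ℝ} (hr : 1 < r) :
    ∃ C : ℝ≥0, C ≠ 0 ∧ 1 + ((2 : ℝ≥0∞) ^ (r - 1))⁻¹ * C ≤ C := by
  have hρ : 1 < (2 : ℝ) ^ (r - 1) := Real.one_lt_rpow (by norm_num) (by linarith)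
  set ρ : ℝ := 2 ^ (r - 1)
  have h2 : (2 : ℝ≥0∞) ^ (r - 1) = ENNReal.ofReal ρ := by
    rw [← ENNReal.ofReal_rpow_of_pos (by norm_num)]; simp
  have hpos : 0 < ρ / (ρ - 1) := div_pos (by linarith) (by linarith)
  refine ⟨(ρ / (ρ - 1)).toNNReal, (Real.toNNReal_pos.2 hpos).ne', ?_⟩
  change 1 + _ * ENNReal.ofReal (ρ / (ρ - 1)) ≤ ENNReal.ofReal (ρ / (ρ - 1))
  rw [h2, ← ENNReal.ofReal_inv_of_pos (by linarith), ← ENNReal.ofReal_mul (by positivity),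
    ← ENNReal.ofReal_one, ← ENNReal.ofReal_add (by norm_num) (by positivity)]
  refine ENNReal.ofReal_le_ofReal (le_of_eq ?_)
  have : ρ - 1 ≠ 0 := by linarith
  have : ρ ≠ 0 := by linarith
  field_simp
  ring

/-- Let `A Q` be the average of `h` and `Y` the left side. Then `Y` is the integral of `h` against
`∑ A Q ^ (r-1) 1_Q`. The members containing a given point form a chain along which `A` at least
doubles, so this sum is at most `C B^{1/r'}` with `B = ∑ A Q ^ r 1_Q` and `∫ B = Y`. Hölder gives `Y
≤ C ‖h‖_r Y^{1/r'}`, and `Y^{1/r'}` is divided out. -/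
theorem sum_principal_average_rpow_le {σ : Measure X} {T : Finset (Set X)} (hTl : IsLaminar T)
    (hTm : ∀ Q ∈ T, MeasurableSet Q) (hT0 : ∀ Q ∈ T, σ Q ≠ 0) (hTT : ∀ Q ∈ T, σ Q ≠ ∞)
    {r : ℝ} (hr : 1 < r) {C : ℝ≥0∞} (hC0 : C ≠ 0)
    (hC : 1 + ((2 : ℝ≥0∞) ^ (r - 1))⁻¹ * C ≤ C)
    {h : X → ℝ≥0∞} (hh : AEMeasurable h σ)
    (hT : ∀ Q ∈ T, ∀ R ∈ T, Q < R →
      2 * ((∫⁻ x in R, h x ∂σ) / σ R) < (∫⁻ x in Q, h x ∂σ) / σ Q) :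
    ∑ Q ∈ T, σ Q * ((∫⁻ x in Q, h x ∂σ) / σ Q) ^ r ≤ C ^ r * ∫⁻ x, h x ^ r ∂σ := by
  classical
  have hr0 : 0 < r := by linarith
  have hconj := Real.HolderConjugate.conjExponent hr
  set r' := Real.conjExponent r
  have hr'0 : 0 < r' := hconj.symm.pos
  set A : Set X → ℝ≥0∞ := fun Q => (∫⁻ x in Q, h x ∂σ) / σ Q with hA
  set H := ∫⁻ x, h x ^ r ∂σ with hH
  rcases eq_or_ne H ∞ with hHT | hHT
  · rw [hHT, ENNReal.mul_top]
    · exact le_top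
    · simp [ENNReal.rpow_eq_zero_iff, hC0, hr0.le]
  -- Hölder against the constant `1` makes the averages finite; hence `Y` is finite and can be
  -- divided out at the end.
  have hAT : ∀ Q ∈ T, A Q ≠ ∞ := by
    intro Q hQ
    refine ENNReal.div_ne_top (ne_top_of_le_ne_top ?_
      (b := H ^ (1 / r) * σ Q ^ (1 / r')) ?_) (hT0 Q hQ)
    · exact ENNReal.mul_ne_top (ENNReal.rpow_ne_top_of_nonneg (by positivity) hHT)
        (ENNReal.rpow_ne_top_of_nonneg (by positivity) (hTT Q hQ))
    · have := ENNReal.lintegral_mul_le_Lp_mul_Lq (σ.restrict Q) hconj hh.restrict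
        (g := fun _ => 1) aemeasurable_const
      simp only [Pi.mul_apply, mul_one, ENNReal.one_rpow, lintegral_const, one_mul,
        Measure.restrict_apply MeasurableSet.univ, Set.univ_inter] at this
      refine this.trans ?_
      gcongr
      exact setLIntegral_le_lintegral _ _
  set B : X → ℝ≥0∞ := fun x => ∑ Q ∈ T, Q.indicator (fun _ => A Q ^ r) x with hB
  set Y := ∑ Q ∈ T, σ Q * A Q ^ r with hY
  have hYT : Y ≠ ∞ := ENNReal.sum_ne_top.2 fun Q hQ =>
    ENNReal.mul_ne_top (hTT Q hQ) (ENNReal.rpow_ne_top_of_nonneg hr0.le (hAT Q hQ))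
  have hBm : Measurable B := Finset.measurable_fun_sum _ fun Q hQ =>
    measurable_const.indicator (hTm Q hQ)
  have hBint : ∫⁻ x, B x ∂σ = Y := by
    rw [hB, lintegral_finsetSum _ fun Q hQ => measurable_const.indicator (hTm Q hQ)]
    refine Finset.sum_congr rfl fun Q hQ => ?_
    rw [lintegral_indicator_const (hTm Q hQ), mul_comm]
  have hpt : ∀ x, ∑ Q ∈ T, Q.indicator (fun _ => A Q ^ (r - 1)) x ≤ C * B x ^ (1 / r') := by
    intro x
    have e1 : ∑ Q ∈ T, Q.indicator (fun _ => A Q ^ (r - 1)) x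
        = ∑ Q ∈ T.filter (x ∈ ·), A Q ^ (r - 1) := by
      rw [Finset.sum_filter]
      rfl
    rw [e1]
    refine (sum_le_mul_sup_of_geometric (ρ := 2 ^ (r - 1)) (C := C) ?_ ?_ hC _ _ ?_).trans ?_
    · simp [ENNReal.rpow_eq_zero_iff]
    · exact ENNReal.rpow_ne_top_of_nonneg (by linarith) (by norm_num)
    · have key : ∀ Q ∈ T, ∀ R ∈ T, Q < R → 2 ^ (r - 1) * A R ^ (r - 1) ≤ A Q ^ (r - 1) := by
        intro Q hQ R hR hlt
        rw [← ENNReal.mul_rpow_of_nonneg _ _ (by linarith)]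
        exact ENNReal.rpow_le_rpow (hT Q hQ R hR hlt).le (by linarith)
      intro Q hQ R hR hne
      obtain ⟨hQT, hxQ⟩ := Finset.mem_filter.1 hQ
      obtain ⟨hRT, hxR⟩ := Finset.mem_filter.1 hR
      rcases hTl Q hQT R hRT with h' | h' | h'
      · exact Or.inr (key Q hQT R hRT (h'.ssubset_of_ne hne))
      · exact Or.inl (key R hRT Q hQT (h'.ssubset_of_ne hne.symm))
      · exact absurd hxR (Set.disjoint_left.1 h' hxQ)
    · gcongr
      refine Finset.sup_le fun Q hQ => ?_
      obtain ⟨hQT, hxQ⟩ := Finset.mem_filter.1 hQ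
      have e2 : A Q ^ (r - 1) = (A Q ^ r) ^ (1 / r') := by
        rw [← ENNReal.rpow_mul]
        congr 1
        have := hconj.inv_add_inv_eq_one
        rw [one_div, eq_sub_of_add_eq' this]
        field_simp
      rw [e2]
      refine ENNReal.rpow_le_rpow ?_ (by positivity)
      have := Finset.single_le_sum (f := fun Q => Q.indicator (fun _ => A Q ^ r) x)
        (fun _ _ => zero_le) hQT
      simpa [Set.indicator_of_mem hxQ] using this
  have hmain : Y ≤ C * H ^ (1 / r) * Y ^ (1 / r') := by
    calc Y = ∑ Q ∈ T, ∫⁻ x, h x * Q.indicator (fun _ => A Q ^ (r - 1)) x ∂σ := by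
          refine Finset.sum_congr rfl fun Q hQ => ?_
          have e3 : ∀ x, h x * Q.indicator (fun _ => A Q ^ (r - 1)) x
              = Q.indicator (fun x => h x * A Q ^ (r - 1)) x := by
            intro x; by_cases hx : x ∈ Q <;> simp [hx]
          simp_rw [e3]
          rw [lintegral_indicator (hTm Q hQ), lintegral_mul_const'' _ hh.restrict]
          have e4 : ∫⁻ x in Q, h x ∂σ = A Q * σ Q :=
            (ENNReal.div_mul_cancel (hT0 Q hQ) (hTT Q hQ)).symm
          have e5 : A Q ^ r = A Q * A Q ^ (r - 1) := by
            conv_rhs => rw [← ENNReal.rpow_one (A Q), ← ENNReal.rpow_mul, one_mul]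
            rw [← ENNReal.rpow_add_of_nonneg _ _ (by norm_num) (by linarith)]
            congr 1; ring
          rw [e4, e5]; ring
      _ = ∫⁻ x, h x * ∑ Q ∈ T, Q.indicator (fun _ => A Q ^ (r - 1)) x ∂σ := by
          simp_rw [Finset.mul_sum]
          exact (lintegral_finsetSum' _ fun Q hQ =>
            hh.mul (measurable_const.indicator (hTm Q hQ)).aemeasurable).symm
      _ ≤ ∫⁻ x, C * (h x * B x ^ (1 / r')) ∂σ := by
          refine lintegral_mono fun x => ?_
          calc _ ≤ h x * (C * B x ^ (1 / r')) := by gcongr; exact hpt x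
            _ = _ := by ring
      _ = C * ∫⁻ x, h x * B x ^ (1 / r') ∂σ :=
          lintegral_const_mul'' _ (hh.mul (hBm.pow_const _).aemeasurable)
      _ ≤ C * (H ^ (1 / r) * Y ^ (1 / r')) := by
          gcongr
          have := ENNReal.lintegral_mul_le_Lp_mul_Lq σ hconj hh
            (g := fun x => B x ^ (1 / r')) (hBm.pow_const _).aemeasurable
          simpa only [Pi.mul_apply, ← ENNReal.rpow_mul, one_div, inv_mul_cancel₀ hr'0.ne',
            ENNReal.rpow_one, hBint] using this
      _ = _ := by ring
  rcases eq_or_ne Y 0 with hY0 | hY0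
  · rw [hY0]; exact zero_le
  have hYr : Y ^ (1 / r) ≤ C * H ^ (1 / r) := by
    have e : Y = Y ^ (1 / r) * Y ^ (1 / r') := by
      rw [← ENNReal.rpow_add _ _ hY0 hYT, one_div, one_div, hconj.inv_add_inv_eq_one,
        ENNReal.rpow_one]
    refine (ENNReal.mul_le_mul_iff_left (c := Y ^ (1 / r')) ?_ ?_).1 (e.symm.le.trans hmain)
    · simp [ENNReal.rpow_eq_zero_iff, hY0, hYT]
    · exact ENNReal.rpow_ne_top_of_nonneg (by positivity) hYT
  have := ENNReal.rpow_le_rpow hYr hr0.le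
  rwa [ENNReal.mul_rpow_of_nonneg _ _ hr0.le, ← ENNReal.rpow_mul, ← ENNReal.rpow_mul, one_div,
    inv_mul_cancel₀ hr0.ne', ENNReal.rpow_one, ENNReal.rpow_one] at this

open Classical in
/-- The Carleson embedding theorem for a finite laminar family. -/
theorem sum_average_rpow_le {σ : Measure X} {S : Finset (Set X)} (hSl : IsLaminar S)
    (hSm : ∀ Q ∈ S, MeasurableSet Q) (hS0 : ∀ Q ∈ S, σ Q ≠ 0) (hST : ∀ Q ∈ S, σ Q ≠ ∞)
    {r : ℝ} (hr : 1 < r) {C : ℝ≥0∞} (hC0 : C ≠ 0)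
    (hC : 1 + ((2 : ℝ≥0∞) ^ (r - 1))⁻¹ * C ≤ C)
    {h : X → ℝ≥0∞} (hh : AEMeasurable h σ) {Λ : ℝ≥0∞}
    (hΛ : ∀ R ∈ S, ∑ Q ∈ S.filter (· ⊆ R), σ Q ≤ Λ * σ R) :
    ∑ Q ∈ S, σ Q * ((∫⁻ x in Q, h x ∂σ) / σ Q) ^ r
      ≤ 2 ^ r * Λ * (C ^ r * ∫⁻ x, h x ^ r ∂σ) := by
  set A : Set X → ℝ≥0∞ := fun Q => (∫⁻ x in Q, h x ∂σ) / σ Q with hA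
  have hr0 : 0 ≤ r := by linarith
  -- Each average is at most twice that of a principal set `R ⊇ Q`; the packing condition then sums
  -- the `σ Q` below each `R`, leaving only the principal sum.
  obtain ⟨T, hTS, h1, h2⟩ := exists_principal_subfamily A (a := 2) (by norm_num) S
  calc ∑ Q ∈ S, σ Q * A Q ^ r
      ≤ ∑ Q ∈ S, ∑ R ∈ T, if Q ⊆ R then σ Q * (2 * A R) ^ r else 0 := by
        refine Finset.sum_le_sum fun Q hQ => ?_
        obtain ⟨R, hR, hQR, hle⟩ := h2 Q hQ
        refine le_trans ?_ (Finset.single_le_sum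
          (f := fun R => if Q ⊆ R then σ Q * (2 * A R) ^ r else 0) (fun _ _ => zero_le) hR)
        have hQR' : Q ⊆ R := hQR
        simp only [hQR', if_true]
        gcongr
    _ = ∑ R ∈ T, (∑ Q ∈ S.filter (· ⊆ R), σ Q) * (2 * A R) ^ r := by
        rw [Finset.sum_comm]
        refine Finset.sum_congr rfl fun R _ => ?_
        rw [← Finset.sum_filter, Finset.sum_mul]
    _ ≤ ∑ R ∈ T, (Λ * σ R) * (2 * A R) ^ r := by
        gcongr with R hR
        exact hΛ R (hTS hR)
    _ = 2 ^ r * Λ * ∑ R ∈ T, σ R * A R ^ r := by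
        rw [Finset.mul_sum]
        refine Finset.sum_congr rfl fun R _ => ?_
        rw [ENNReal.mul_rpow_of_nonneg _ _ hr0]
        ring
    _ ≤ _ := by
        gcongr
        exact sum_principal_average_rpow_le (hSl.mono hTS) (fun Q hQ => hSm Q (hTS hQ))
          (fun Q hQ => hS0 Q (hTS hQ)) (fun Q hQ => hST Q (hTS hQ)) hr hC0 hC hh h1

/-! ### The weighted estimate on one finite laminar family. -/

theorem ENNReal.prod_const_rpow_of_sum_eq_one {ι : Type*} {s : Finset ι} {p : ι → ℝ} {x : ℝ≥0∞}
    (hx : x ≠ 0) (hx' : x ≠ ∞) (hp : ∑ i ∈ s, p i = 1) : ∏ i ∈ s, x ^ p i = x := by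
  have : ∀ t : Finset ι, ∏ i ∈ t, x ^ p i = x ^ ∑ i ∈ t, p i := by
    classical
    intro t
    induction t using Finset.induction_on with
    | empty => simp
    | insert a t ha ih => rw [Finset.prod_insert ha, Finset.sum_insert ha, ih,
        ENNReal.rpow_add _ _ hx hx']
  rw [this, hp, ENNReal.rpow_one]

/-- The `μ`-average of `h i` times `σ i` is the `σ i`-average of `h i` times `σ i Q / μ Q`. The
power `q` of the latter splits as `q/r' + q/r`: the first part, with `ν Q / μ Q`, is bounded by `K`,
and the second becomes `σ i Q ^ (q/r)` once `μ Q` is distributed as `∏ μ Q ^ (q/r i)`. -/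
theorem avgProd_rpow_mul_le {m : ℕ} {μ ν : Measure X} {σ : Fin m → Measure X}
    {h : Fin m → X → ℝ≥0∞} {r : Fin m → ℝ} (hr : ∀ i, 1 < r i) {q : ℝ} (hq : 0 < q)
    (hqr : ∑ i, q / r i = 1) {K : ℝ≥0∞} {Q : Set X} (hQm : MeasurableSet Q) (hQ0 : μ Q ≠ 0)
    (hQT : μ Q ≠ ∞) (hσ0 : ∀ i, σ i Q ≠ 0) (hσT : ∀ i, σ i Q ≠ ∞)
    (hK : (∏ i, (σ i Q / μ Q) ^ (q / Real.conjExponent (r i))) * (ν Q / μ Q) ≤ K) :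
    avgProd μ (fun i => (σ i).withDensity (h i)) Q ^ q * ν Q ≤
      K * ∏ i, (σ i Q * ((∫⁻ x in Q, h i x ∂σ i) / σ i Q) ^ r i) ^ (q / r i) := by
  have hr0 : ∀ i, 0 < r i := fun i => by linarith [hr i]
  have e1 : avgProd μ (fun i => (σ i).withDensity (h i)) Q
      = ∏ i, ((∫⁻ x in Q, h i x ∂σ i) / σ i Q) * (σ i Q / μ Q) := by
    have : ∀ i, ((∫⁻ x in Q, h i x ∂σ i) / σ i Q) * (σ i Q / μ Q)
        = (∫⁻ x in Q, h i x ∂σ i) * (μ Q)⁻¹ := fun i => by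
      rw [div_eq_mul_inv (σ i Q), ← mul_assoc, ENNReal.div_mul_cancel (hσ0 i) (hσT i)]
    rw [Finset.prod_congr rfl fun i _ => this i]
    simp only [Finset.prod_mul_distrib, avgProd, div_eq_mul_inv, withDensity_apply _ hQm,
      Finset.prod_const, Finset.card_univ, Fintype.card_fin, ENNReal.inv_pow]
  have e2 : ∀ i, (σ i Q / μ Q) ^ q
      = (σ i Q / μ Q) ^ (q / Real.conjExponent (r i)) * (σ i Q / μ Q) ^ (q / r i) := fun i => by
    have hc := Real.HolderConjugate.conjExponent (hr i)
    rw [← ENNReal.rpow_add_of_nonneg _ _ (div_nonneg hq.le hc.symm.nonneg)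
      (div_nonneg hq.le (hr0 i).le)]
    congr 1
    rw [div_eq_mul_inv, div_eq_mul_inv, ← mul_add, add_comm, hc.inv_add_inv_eq_one, mul_one]
  have e3 : ∏ i, (σ i Q) ^ (q / r i) = (∏ i, (σ i Q / μ Q) ^ (q / r i)) * μ Q := by
    nth_rw 2 [← ENNReal.prod_const_rpow_of_sum_eq_one hQ0 hQT hqr]
    rw [← Finset.prod_mul_distrib]
    refine Finset.prod_congr rfl fun i _ => ?_
    rw [← ENNReal.mul_rpow_of_nonneg _ _ (div_nonneg hq.le (hr0 i).le),
      ENNReal.div_mul_cancel hQ0 hQT]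
  have e4 : ∀ i, (((∫⁻ x in Q, h i x ∂σ i) / σ i Q) ^ r i) ^ (q / r i)
      = ((∫⁻ x in Q, h i x ∂σ i) / σ i Q) ^ q := fun i => by
    rw [← ENNReal.rpow_mul, mul_div_cancel₀ _ (hr0 i).ne']
  simp_rw [ENNReal.mul_rpow_of_nonneg _ _ (div_nonneg hq.le (hr0 _).le), e4,
    Finset.prod_mul_distrib, e3]
  rw [e1, ← ENNReal.prod_rpow_of_nonneg hq.le]
  simp_rw [ENNReal.mul_rpow_of_nonneg _ _ hq.le, e2, Finset.prod_mul_distrib]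
  calc _ = ((∏ i, (σ i Q / μ Q) ^ (q / Real.conjExponent (r i))) * (ν Q / μ Q)) *
        ((∏ i, (σ i Q / μ Q) ^ (q / r i)) * μ Q *
          ∏ i, ((∫⁻ x in Q, h i x ∂σ i) / σ i Q) ^ q) := by
        conv_lhs => rw [← ENNReal.div_mul_cancel (a := μ Q) (b := ν Q) hQ0 hQT]
        ring
    _ ≤ _ := by gcongr

/-- Principal sets replace the supremum by a sum, the `A_P` bound `K` acts termwise, Hölder
separates the indices, and Carleson embedding handles each. The majorant `g` in `hΛ` plays the role
of the localized maximal function of `σ i`. -/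
theorem lintegral_sup_avgProd_le {m : ℕ} (hm : 0 < m) {μ ν : Measure X} {σ : Fin m → Measure X}
    {h : Fin m → X → ℝ≥0∞} (hh : ∀ i, AEMeasurable (h i) (σ i)) {r : Fin m → ℝ}
    (hr : ∀ i, 1 < r i) {C : Fin m → ℝ≥0∞} (hC0 : ∀ i, C i ≠ 0)
    (hC : ∀ i, 1 + ((2 : ℝ≥0∞) ^ (r i - 1))⁻¹ * C i ≤ C i) {q : ℝ} (hq : 0 < q)
    (hqr : ∑ i, q / r i = 1) {K : ℝ≥0∞} {Λ : Fin m → ℝ≥0∞} {F : Finset (Set X)}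
    (hFl : IsLaminar F) (hFm : ∀ Q ∈ F, MeasurableSet Q) (hF0 : ∀ Q ∈ F, μ Q ≠ 0)
    (hFT : ∀ Q ∈ F, μ Q ≠ ∞) (hσ0 : ∀ Q ∈ F, ∀ i, σ i Q ≠ 0) (hσT : ∀ Q ∈ F, ∀ i, σ i Q ≠ ∞)
    (hK : ∀ Q ∈ F,
      (∏ i, (σ i Q / μ Q) ^ (q / Real.conjExponent (r i))) * (ν Q / μ Q) ≤ K)
    (hΛ : ∀ R ∈ F, ∀ i, ∃ g : X → ℝ≥0∞, (∀ Q ∈ F, Q ⊆ R → ∀ x ∈ Q, σ i Q / μ Q ≤ g x) ∧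
      ∫⁻ x in R, g x ∂μ ≤ Λ i * σ i R) :
    ∫⁻ x, F.sup (fun Q => Q.indicator
        (fun _ => avgProd μ (fun i => (σ i).withDensity (h i)) Q ^ q) x) ∂ν ≤
      (2 ^ m) ^ q * K *
        ∏ i, (2 ^ r i * (2 * Λ i) * (C i ^ r i * ∫⁻ x, h i x ^ r i ∂σ i)) ^ (q / r i) := by
  classical
  set P : Set X → ℝ≥0∞ := avgProd μ (fun i => (σ i).withDensity (h i)) with hP
  obtain ⟨S, hSF, h1, h2⟩ := exists_principal_subfamily P (a := 2 ^ m)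
    (one_le_pow₀ (by norm_num)) F
  have hSm : ∀ Q ∈ S, MeasurableSet Q := fun Q hQ => hFm Q (hSF hQ)
  have hS0 : ∀ Q ∈ S, μ Q ≠ 0 := fun Q hQ => hF0 Q (hSF hQ)
  have hST : ∀ Q ∈ S, μ Q ≠ ∞ := fun Q hQ => hFT Q (hSF hQ)
  have hqr0 : ∀ i, 0 ≤ q / r i := fun i => div_nonneg hq.le (by linarith [hr i])
  calc ∫⁻ x, F.sup (fun Q => Q.indicator (fun _ => P Q ^ q) x) ∂ν
      ≤ ∫⁻ x, ∑ Q ∈ S, Q.indicator (fun _ => (2 ^ m) ^ q * P Q ^ q) x ∂ν := by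
        refine lintegral_mono fun x => Finset.sup_le fun Q hQ => ?_
        obtain ⟨R, hR, hQR, hle⟩ := h2 Q hQ
        refine le_trans ?_ (Finset.single_le_sum
          (f := fun R => R.indicator (fun _ => (2 ^ m) ^ q * P R ^ q) x)
          (fun _ _ => zero_le) hR)
        by_cases hx : x ∈ Q
        · rw [Set.indicator_of_mem hx, Set.indicator_of_mem (hQR hx),
            ← ENNReal.mul_rpow_of_nonneg _ _ hq.le]
          exact ENNReal.rpow_le_rpow hle hq.le
        · simp [Set.indicator_of_notMem hx]
    _ = (2 ^ m) ^ q * ∑ Q ∈ S, P Q ^ q * ν Q := by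
        rw [lintegral_finsetSum _ fun Q hQ => measurable_const.indicator (hSm Q hQ),
          Finset.mul_sum]
        refine Finset.sum_congr rfl fun Q hQ => ?_
        rw [lintegral_indicator_const (hSm Q hQ), mul_assoc]
    _ ≤ (2 ^ m) ^ q * ∑ Q ∈ S,
          K * ∏ i, (σ i Q * ((∫⁻ x in Q, h i x ∂σ i) / σ i Q) ^ r i) ^ (q / r i) := by
        refine mul_le_mul_right (Finset.sum_le_sum fun Q hQ => ?_) _
        exact avgProd_rpow_mul_le hr hq hqr (hSm Q hQ) (hS0 Q hQ) (hST Q hQ)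
          (hσ0 Q (hSF hQ)) (hσT Q (hSF hQ)) (hK Q (hSF hQ))
    _ ≤ (2 ^ m) ^ q * (K * ∏ i, (∑ Q ∈ S,
          σ i Q * ((∫⁻ x in Q, h i x ∂σ i) / σ i Q) ^ r i) ^ (q / r i)) := by
        rw [← Finset.mul_sum]
        gcongr
        exact sum_prod_rpow_le_prod_sum_rpow S Finset.univ
          (fun i Q => σ i Q * ((∫⁻ x in Q, h i x ∂σ i) / σ i Q) ^ r i) hqr (fun i _ => hqr0 i)
    _ ≤ _ := by
        rw [← mul_assoc]
        refine mul_le_mul_right (Finset.prod_le_prod' fun i _ => ENNReal.rpow_le_rpow ?_ (hqr0 i)) _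
        refine sum_average_rpow_le (hFl.mono hSF) hSm (fun Q hQ => hσ0 Q (hSF hQ) i)
          (fun Q hQ => hσT Q (hSF hQ) i) (hr i) (hC0 i) (hC i) (hh i) fun R hR => ?_
        obtain ⟨g, hg, hgR⟩ := hΛ R (hSF hR) i
        refine (sum_measure_le_two_mul_lintegral (hFl.mono hSF) hSm hS0 hST (fun Q hQ =>
          measure_le_two_mul_ownPart hm (hFl.mono hSF) hSm hS0 hST h1 hQ)
          (fun Q hQ hQR => hg Q (hSF hQ) hQR)).trans ?_
        rw [mul_assoc]
        gcongr

end

/-! ### Cubes, shifted dyadic grids and the one-third trick. -/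

/-- The offset, relative to the side length `2 ^ K`, of the shifted grid at scale `K`. -/
noncomputable def gridOffset (α : Bool) (K : ℤ) : ℝ := if α then (-1) ^ K / 3 else 0

/-- The index of the dyadic interval of length `2 ^ K` of the (shifted) grid containing `t`. -/
noncomputable def gridIndex (α : Bool) (K : ℤ) (t : ℝ) : ℤ := ⌊t / 2 ^ K - gridOffset α K⌋

theorem gridIndex_mono (α : Bool) (K : ℤ) : Monotone (gridIndex α K) := fun s t h =>
  Int.floor_le_floor (by gcongr)

theorem gridIndex_eq_iff {α : Bool} {K c : ℤ} {t : ℝ} :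
    gridIndex α K t = c ↔ 2 ^ K * (c + gridOffset α K) ≤ t ∧
      t < 2 ^ K * (c + gridOffset α K) + 2 ^ K := by
  have h2 : (0 : ℝ) < 2 ^ K := by positivity
  rw [gridIndex, Int.floor_eq_iff, le_sub_iff_add_le, sub_lt_iff_lt_add, le_div_iff₀ h2,
    div_lt_iff₀ h2]
  constructor <;> rintro ⟨h, h'⟩ <;> constructor <;> nlinarith

theorem gridIndex_succ_congr {α : Bool} {K : ℤ} {s t : ℝ}
    (h : gridIndex α K s = gridIndex α K t) : gridIndex α (K + 1) s = gridIndex α (K + 1) t := by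
  -- The grids are nested because the offset `ε/3` changes sign with the scale: `t/2^(K+1) + ε/3` is
  -- half of `(t/2^K - ε/3) + ε`, and `ε` is an integer.
  have key : ∀ t, gridIndex α (K + 1) t =
      (gridIndex α K t + if α then (-1) ^ K.natAbs else 0) / 2 := by
    intro t
    set ε : ℤ := if α then (-1) ^ K.natAbs else 0 with hε
    have hoff : gridOffset α K = ε / 3 := by
      cases α
      · simp [gridOffset, hε]
      · simp only [gridOffset, hε, if_true]
        push_cast
        congr 1
        rcases Int.even_or_odd K with hK | hK
        · rw [hK.neg_one_zpow, (Int.natAbs_even.2 hK).neg_one_pow]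
        · rw [hK.neg_one_zpow, (Int.natAbs_odd.2 hK).neg_one_pow]
    have hoff' : gridOffset α (K + 1) = -gridOffset α K := by
      cases α
      · simp [gridOffset]
      · simp only [gridOffset, if_true]
        rw [zpow_add_one₀ (by norm_num)]
        ring
    rw [gridIndex, hoff', hoff, zpow_add_one₀ (by norm_num), gridIndex, hoff,
      ← Int.floor_add_intCast]
    rw [show (2 : ℤ) = ((2 : ℕ) : ℤ) by rfl, ← Int.floor_div_natCast]
    congr 1
    push_cast
    ring
  rw [key, key, h]

theorem gridIndex_congr_of_le {α : Bool} {K L : ℤ} (hKL : K ≤ L) {s t : ℝ}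
    (h : gridIndex α K s = gridIndex α K t) : gridIndex α L s = gridIndex α L t := by
  induction L, hKL using Int.leInduction with
  | base => exact h
  | succ L _ ih => exact gridIndex_succ_congr ih

/-- A short interval lies in one dyadic interval of the standard grid or of the shifted grid. -/
theorem exists_gridIndex_eq {K : ℤ} {a b : ℝ} (hab : a ≤ b) (h : b - a ≤ 2 ^ K / 3) :
    ∃ α, gridIndex α K a = gridIndex α K b := by
  by_contra! hne
  have h0 := lt_of_le_of_ne (gridIndex_mono false K hab) (hne false)
  have h1 := lt_of_le_of_ne (gridIndex_mono true K hab) (hne true)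
  have h2 : (0 : ℝ) < 2 ^ K := by positivity
  have hu : b / 2 ^ K - a / 2 ^ K ≤ 1 / 3 := by
    rw [← sub_div, div_le_iff₀ h2]; linarith
  have e0 : a / 2 ^ K < gridIndex false K b ∧ (gridIndex false K b : ℝ) ≤ b / 2 ^ K := by
    constructor
    · simpa [gridIndex, gridOffset] using Int.floor_lt.1 h0
    · simpa [gridIndex, gridOffset] using Int.floor_le (b / 2 ^ K)
  have e1 : a / 2 ^ K - gridOffset true K < gridIndex true K b ∧
      (gridIndex true K b : ℝ) ≤ b / 2 ^ K - gridOffset true K :=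
    ⟨Int.floor_lt.1 h1, Int.floor_le _⟩
  have hoff : gridOffset true K = 1 / 3 ∨ gridOffset true K = -1 / 3 := by
    rcases Int.even_or_odd K with hK | hK
    · left; simp [gridOffset, hK.neg_one_zpow]
    · right; simp [gridOffset, hK.neg_one_zpow]
  generalize gridIndex false K b = i at e0
  generalize gridIndex true K b = j at e1
  -- In units of `2 ^ K`, the grid points `i` and `j + offset` both lie in an interval of length at
  -- most `1/3`, open on the left. So `3(i - j)` lies strictly between `0` and `2`, or between `-2`
  -- and `0`, which is impossible for a multiple of `3`.
  rcases hoff with ho | ho <;> rw [ho] at e1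
  · have hA : ((3 * (i - j) : ℤ) : ℝ) < ((2 : ℤ) : ℝ) := by push_cast; linarith
    have hB : ((0 : ℤ) : ℝ) < ((3 * (i - j) : ℤ) : ℝ) := by push_cast; linarith
    have := Int.cast_lt.1 hA
    have := Int.cast_lt.1 hB
    omega
  · have hA : ((3 * (i - j) : ℤ) : ℝ) < ((0 : ℤ) : ℝ) := by push_cast; linarith
    have hB : ((-2 : ℤ) : ℝ) < ((3 * (i - j) : ℤ) : ℝ) := by push_cast; linarith
    have := Int.cast_lt.1 hA
    have := Int.cast_lt.1 hB
    omega

theorem volume_closedCube {n : ℕ} (a : EuclideanSpace ℝ (Fin n)) (l : ℝ) :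
    volume {x : EuclideanSpace ℝ (Fin n) | ∀ j, a j ≤ x j ∧ x j ≤ a j + l}
      = ENNReal.ofReal l ^ n := by
  have := (EuclideanSpace.volume_preserving_symm_measurableEquiv_toLp (Fin n)).measure_preimage_equiv
    (Set.Icc (fun j => a j) (fun j => a j + l))
  rw [Real.volume_Icc_pi] at this
  simp only [add_sub_cancel_left, Finset.prod_const, Finset.card_univ, Fintype.card_fin] at this
  rw [← this]
  congr 1
  ext x
  simp [Pi.le_def, forall_and]

theorem volume_halfOpenCube {n : ℕ} (a : Fin n → ℝ) (l : ℝ) :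
    volume {x : EuclideanSpace ℝ (Fin n) | ∀ j, a j ≤ x j ∧ x j < a j + l}
      = ENNReal.ofReal l ^ n := by
  have := (EuclideanSpace.volume_preserving_symm_measurableEquiv_toLp (Fin n)).measure_preimage_equiv
    (Set.univ.pi fun j => Set.Ico (a j) (a j + l))
  rw [Real.volume_pi_Ico] at this
  simp only [add_sub_cancel_left, Finset.prod_const, Finset.card_univ, Fintype.card_fin] at this
  rw [← this]
  congr 1
  ext x
  simp

theorem IsCube.measurableSet {n : ℕ} {Q : Set (EuclideanSpace ℝ (Fin n))} (hQ : IsCube Q) :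
    MeasurableSet Q := by
  obtain ⟨a, l, -, rfl⟩ := hQ
  simp only [Set.ofPred_forall, Set.ofPred_and]
  refine MeasurableSet.iInter fun j => ?_
  exact (measurableSet_le measurable_const (by fun_prop)).inter
    (measurableSet_le (by fun_prop) measurable_const)

theorem IsCube.volume_ne_zero {n : ℕ} {Q : Set (EuclideanSpace ℝ (Fin n))} (hQ : IsCube Q) :
    volume Q ≠ 0 := by
  obtain ⟨a, l, hl, rfl⟩ := hQ
  rw [volume_closedCube]
  exact pow_ne_zero _ (by simpa using hl)

theorem IsCube.volume_ne_top {n : ℕ} {Q : Set (EuclideanSpace ℝ (Fin n))} (hQ : IsCube Q) :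
    volume Q ≠ ∞ := by
  obtain ⟨a, l, hl, rfl⟩ := hQ
  rw [volume_closedCube]
  exact ENNReal.pow_ne_top ENNReal.ofReal_ne_top

/-- The half-open dyadic cube with index `c` and side `2 ^ K` of the grid shifted by `α`. -/
def gridCell {n : ℕ} (α : Fin n → Bool) (d : ℤ × (Fin n → ℤ)) :
    Set (EuclideanSpace ℝ (Fin n)) :=
  {x | ∀ j, gridIndex (α j) d.1 (x j) = d.2 j}

theorem gridCell_eq {n : ℕ} (α : Fin n → Bool) (d : ℤ × (Fin n → ℤ)) :
    gridCell α d = {x | ∀ j, 2 ^ d.1 * (d.2 j + gridOffset (α j) d.1) ≤ x j ∧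
      x j < 2 ^ d.1 * (d.2 j + gridOffset (α j) d.1) + 2 ^ d.1} := by
  ext x
  simp [gridCell, gridIndex_eq_iff]

theorem volume_gridCell {n : ℕ} (α : Fin n → Bool) (d : ℤ × (Fin n → ℤ)) :
    volume (gridCell α d) = ENNReal.ofReal (2 ^ d.1) ^ n := by
  rw [gridCell_eq, volume_halfOpenCube]

theorem measurableSet_gridCell {n : ℕ} (α : Fin n → Bool) (d : ℤ × (Fin n → ℤ)) :
    MeasurableSet (gridCell α d) := by
  rw [gridCell_eq]
  simp only [Set.ofPred_forall, Set.ofPred_and]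
  refine MeasurableSet.iInter fun j => ?_
  exact (measurableSet_le measurable_const (by fun_prop)).inter
    (measurableSet_lt (by fun_prop) measurable_const)

/-- The weight constants are suprema over closed cubes while the cells are half-open; the difference
is null. -/
theorem exists_isCube_ae_eq_gridCell {n : ℕ} (α : Fin n → Bool) (d : ℤ × (Fin n → ℤ)) :
    ∃ R, IsCube R ∧ gridCell α d ⊆ R ∧ gridCell α d =ᵐ[volume] R := by
  set a : EuclideanSpace ℝ (Fin n) :=
    WithLp.toLp 2 fun j => 2 ^ d.1 * (d.2 j + gridOffset (α j) d.1) with ha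
  set R := {x : EuclideanSpace ℝ (Fin n) | ∀ j, a j ≤ x j ∧ x j ≤ a j + 2 ^ d.1} with hR
  have hsub : gridCell α d ⊆ R := by
    rw [gridCell_eq]
    exact fun x hx j => ⟨(hx j).1, (hx j).2.le⟩
  have hvR : volume R = ENNReal.ofReal (2 ^ d.1) ^ n := volume_closedCube a _
  refine ⟨R, ⟨a, 2 ^ d.1, by positivity, rfl⟩, hsub, ae_eq_of_subset_of_measure_ge hsub
    (le_of_eq (by rw [hvR, volume_gridCell])) (measurableSet_gridCell α d).nullMeasurableSet ?_⟩
  rw [hvR]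
  exact ENNReal.pow_ne_top ENNReal.ofReal_ne_top

theorem gridCell_subset_or_disjoint {n : ℕ} (α : Fin n → Bool) {d e : ℤ × (Fin n → ℤ)}
    (hde : d.1 ≤ e.1) : gridCell α d ⊆ gridCell α e ∨ Disjoint (gridCell α d) (gridCell α e) := by
  by_cases h : ∃ x, x ∈ gridCell α d ∧ x ∈ gridCell α e
  · obtain ⟨x, hxd, hxe⟩ := h
    refine Or.inl fun y hy j => ?_
    rw [← hxe j]
    exact gridIndex_congr_of_le hde ((hy j).trans (hxd j).symm)
  · push Not at h
    exact Or.inr (Set.disjoint_left.2 h)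

open Classical in
theorem isLaminar_image_gridCell {n : ℕ} (α : Fin n → Bool) (F : Finset (ℤ × (Fin n → ℤ))) :
    IsLaminar (F.image (gridCell α)) := by
  intro Q hQ R hR
  obtain ⟨d, -, rfl⟩ := Finset.mem_image.1 hQ
  obtain ⟨e, -, rfl⟩ := Finset.mem_image.1 hR
  rcases le_total d.1 e.1 with h | h
  · rcases gridCell_subset_or_disjoint α h with h | h
    exacts [Or.inl h, Or.inr (Or.inr h)]
  · rcases gridCell_subset_or_disjoint α h with h | h
    exacts [Or.inr (Or.inl h), Or.inr (Or.inr h.symm)]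

/-- Every cube lies in a comparable dyadic cube of one of the `2 ^ n` shifted grids. -/
theorem IsCube.exists_subset_gridCell {n : ℕ} {Q : Set (EuclideanSpace ℝ (Fin n))}
    (hQ : IsCube Q) : ∃ (α : Fin n → Bool) (d : ℤ × (Fin n → ℤ)), Q ⊆ gridCell α d ∧
      volume (gridCell α d) ≤ 6 ^ n * volume Q := by
  obtain ⟨a, l, hl, rfl⟩ := hQ
  -- From `2^K < 3l ≤ 2^(K+1)`, the scale `K + 1` is coarse enough for the one-third trick in each
  -- coordinate, and its side is less than `6l`.
  obtain ⟨K, hK1, hK2⟩ := exists_mem_Ioc_zpow (x := 3 * l) (y := (2 : ℝ)) (by positivity)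
    (by norm_num)
  have hα : ∀ j, ∃ α, gridIndex α (K + 1) (a j) = gridIndex α (K + 1) (a j + l) := fun j =>
    exists_gridIndex_eq (by linarith) (by linarith)
  choose α hα using hα
  refine ⟨α, (K + 1, fun j => gridIndex (α j) (K + 1) (a j)), fun x hx j => ?_, ?_⟩
  · exact le_antisymm ((gridIndex_mono _ _ (hx j).2).trans (hα j).ge)
      (gridIndex_mono _ _ (hx j).1)
  · rw [volume_gridCell, volume_closedCube, ← mul_pow]
    gcongr
    rw [show (6 : ℝ≥0∞) = ENNReal.ofReal 6 by simp, ← ENNReal.ofReal_mul (by norm_num)]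
    refine ENNReal.ofReal_le_ofReal ?_
    change (2 : ℝ) ^ (K + 1) ≤ 6 * l
    rw [zpow_add_one₀ (by norm_num)]
    linarith

theorem IsCube.exists_exhaustion {n : ℕ} {Q : Set (EuclideanSpace ℝ (Fin n))} (hQ : IsCube Q) :
    ∃ R : ℕ → Set (EuclideanSpace ℝ (Fin n)), (∀ N, IsCube (R N)) ∧ (∀ N, Q ⊆ R N) ∧
      ⋃ N, R N = Set.univ := by
  obtain ⟨a, l, hl, rfl⟩ := hQ
  refine ⟨fun N => {x | ∀ j, (WithLp.toLp 2 fun j => a j - N : EuclideanSpace ℝ (Fin n)) j ≤ x j ∧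
      x j ≤ (WithLp.toLp 2 fun j => a j - N : EuclideanSpace ℝ (Fin n)) j + (l + 2 * N)},
    fun N => ⟨_, l + 2 * N, by positivity, rfl⟩, fun N x hx j => ?_, ?_⟩
  · have hN : (0 : ℝ) ≤ N := by positivity
    have := hx j
    constructor <;> simp only <;> linarith [this.1, this.2]
  · refine Set.eq_univ_of_forall fun x => Set.mem_iUnion.2 ?_
    obtain ⟨N, hN⟩ := exists_nat_ge (∑ j, |x j - a j|)
    refine ⟨N, fun j => ?_⟩
    have h1 : |x j - a j| ≤ N :=
      (Finset.single_le_sum (f := fun j => |x j - a j|) (fun _ _ => abs_nonneg _)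
        (Finset.mem_univ j)).trans hN
    have := abs_le.1 h1
    constructor <;> simp only <;> linarith [this.1, this.2]

theorem exists_isCube (n : ℕ) : ∃ Q : Set (EuclideanSpace ℝ (Fin n)), IsCube Q :=
  ⟨_, 0, 1, one_pos, rfl⟩

/-! ### Dual weights and the multilinear maximal function. -/

section Weights
variable {n : ℕ} {r : ℝ} {w : EuclideanSpace ℝ (Fin n) → ℝ≥0}

theorem aemeasurable_dualWeight (hw : AEMeasurable w volume) :
    AEMeasurable (dualWeight r w) volume := hw.coe_nnreal_ennreal.pow_const _

theorem dualWeight_ne_zero (hr : 1 < r) (x : EuclideanSpace ℝ (Fin n)) : dualWeight r w x ≠ 0 := by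
  have := (Real.HolderConjugate.conjExponent hr).symm.lt
  simp only [dualWeight, ne_eq, ENNReal.rpow_eq_zero_iff, ENNReal.coe_ne_top, false_and, or_false]
  rintro ⟨-, h⟩
  linarith

theorem setLIntegral_dualWeight_ne_zero (hr : 1 < r) (hw : AEMeasurable w volume)
    {Q : Set (EuclideanSpace ℝ (Fin n))} (hQ : volume Q ≠ 0) :
    ∫⁻ x in Q, dualWeight r w x ≠ 0 := by
  intro h
  rw [lintegral_eq_zero_iff' (aemeasurable_dualWeight hw).restrict] at h
  have h2 : ∀ᵐ x ∂(volume.restrict Q), False := by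
    filter_upwards [h] with x hx using dualWeight_ne_zero hr x hx
  rw [Filter.eventually_false_iff_eq_bot, ae_eq_bot, Measure.restrict_eq_zero] at h2
  exact hQ h2

theorem dualWeight_ne_top_iff (hr : 1 < r) (x : EuclideanSpace ℝ (Fin n)) :
    dualWeight r w x ≠ ∞ ↔ w x ≠ 0 := by
  have := (Real.HolderConjugate.conjExponent hr).symm.lt
  simp [dualWeight, ENNReal.rpow_eq_top_iff, this]

/-- With `σ = dualWeight r w`, the identity `(1 - r')(1 - r) = 1` gives `w = σ^(1-r)`. Thus writing
`y = hσ` turns `y^r w` into `h^r σ`. -/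
theorem dualWeight_rpow_mul (hr : 1 < r) {x : EuclideanSpace ℝ (Fin n)} (hx : w x ≠ 0) (y : ℝ≥0∞) :
    dualWeight r w x * (y / dualWeight r w x) ^ r = y ^ r * w x := by
  have h0 := dualWeight_ne_zero (w := w) hr x
  have hT := (dualWeight_ne_top_iff hr x).2 hx
  have hx' : (w x : ℝ≥0∞) ≠ 0 := by simpa using hx
  have hr0 : 0 < r := by linarith
  have e : (w x : ℝ≥0∞) = dualWeight r w x ^ (1 - r) := by
    rw [dualWeight, ← ENNReal.rpow_mul]
    have : (1 - r.conjExponent) * (1 - r) = 1 := by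
      have : r - 1 ≠ 0 := by linarith
      rw [Real.conjExponent]
      field_simp
      ring
    rw [this, ENNReal.rpow_one]
  rw [ENNReal.div_rpow_of_nonneg _ _ hr0.le, e, ENNReal.rpow_sub _ _ h0 hT, ENNReal.rpow_one,
    div_eq_mul_inv, div_eq_mul_inv]
  ring

end Weights

theorem cubeAvg_eq_div {n : ℕ} (Q : Set (EuclideanSpace ℝ (Fin n)))
    (g : EuclideanSpace ℝ (Fin n) → ℝ≥0∞) : cubeAvg Q g = (∫⁻ y in Q, g y) / volume Q := by
  rw [cubeAvg, mul_comm, div_eq_mul_inv]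

section
variable {n m : ℕ} {q : ℝ} {r : Fin m → ℝ} {ω : Fin m → EuclideanSpace ℝ (Fin n) → ℝ≥0}

/-- If some dual weight is not locally integrable, then the joint weight of an `A_P` tuple vanishes
almost everywhere. -/
theorem withDensity_jointWeight_eq_zero (hr : ∀ i, 1 < r i) (hq : 0 < q)
    (hω : ∀ i, AEMeasurable (ω i) volume) (hap : apConst q r ω < ∞)
    {Q : Set (EuclideanSpace ℝ (Fin n))} (hQ : IsCube Q) {i : Fin m}
    (hi : ∫⁻ x in Q, dualWeight (r i) (ω i) x = ∞) :
    volume.withDensity (jointWeight q r ω) = 0 := by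
  obtain ⟨R, hR, hQR, hU⟩ := hQ.exists_exhaustion
  rw [← Measure.measure_univ_eq_zero, ← hU]
  refine measure_iUnion_null fun N => ?_
  rw [withDensity_apply _ (hR N).measurableSet]
  have hc : ∀ j, 0 < q / Real.conjExponent (r j) := fun j =>
    div_pos hq (Real.HolderConjugate.conjExponent (hr j)).symm.pos
  have hle : (∏ j, cubeAvg (R N) (dualWeight (r j) (ω j)) ^ (q / Real.conjExponent (r j))) *
      cubeAvg (R N) (jointWeight q r ω) ≤ apConst q r ω :=
    le_iSup₂ (f := fun (Q : Set (EuclideanSpace ℝ (Fin n))) (_ : IsCube Q) =>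
      (∏ i, cubeAvg Q (dualWeight (r i) (ω i)) ^ (q / Real.conjExponent (r i))) *
      cubeAvg Q (jointWeight q r ω)) (R N) (hR N)
  -- The `i`-th factor is infinite on every cube containing `Q` and the others are nonzero, so
  -- finiteness of the `A_P` constant forces the joint weight to have mass zero on each `R N`.
  have htop : ∏ j, cubeAvg (R N) (dualWeight (r j) (ω j)) ^ (q / Real.conjExponent (r j)) = ∞ := by
    rw [← Finset.mul_prod_erase _ _ (Finset.mem_univ i)]
    have h1 : cubeAvg (R N) (dualWeight (r i) (ω i)) = ∞ := by
      have : ∫⁻ x in R N, dualWeight (r i) (ω i) x = ∞ :=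
        top_le_iff.1 (hi ▸ lintegral_mono_set (hQR N))
      rw [cubeAvg_eq_div, this, ENNReal.top_div_of_ne_top (hR N).volume_ne_top]
    rw [h1, ENNReal.top_rpow_of_pos (hc i), ENNReal.top_mul]
    refine Finset.prod_ne_zero_iff.2 fun j _ => ?_
    have h2 : cubeAvg (R N) (dualWeight (r j) (ω j)) ≠ 0 := by
      rw [cubeAvg_eq_div]
      exact ENNReal.div_ne_zero.2 ⟨setLIntegral_dualWeight_ne_zero (hr j) (hω j)
        (hR N).volume_ne_zero, (hR N).volume_ne_top⟩
    simp [ENNReal.rpow_eq_zero_iff, h2, (hc j).le]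
  by_contra hne
  rw [htop, ENNReal.top_mul] at hle
  · exact hap.ne (top_le_iff.1 hle)
  · rw [cubeAvg_eq_div]
    exact ENNReal.div_ne_zero.2 ⟨hne, (hR N).volume_ne_top⟩

/-- The strong bound for the maximal function restricted to one dyadic grid. -/
theorem lintegral_iSup_gridCell_le (hm : 0 < m) (hr : ∀ i, 1 < r i) {C : Fin m → ℝ≥0∞}
    (hC0 : ∀ i, C i ≠ 0) (hC : ∀ i, 1 + ((2 : ℝ≥0∞) ^ (r i - 1))⁻¹ * C i ≤ C i) (hq : 0 < q)
    (hqr : ∑ i, q / r i = 1) (hω : ∀ i, AEMeasurable (ω i) volume)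
    (hloc : ∀ Q : Set (EuclideanSpace ℝ (Fin n)), IsCube Q → ∀ i,
      ∫⁻ x in Q, dualWeight (r i) (ω i) x ≠ ∞)
    {g : Fin m → EuclideanSpace ℝ (Fin n) → ℝ≥0∞} (hg : ∀ i, AEMeasurable (g i) volume)
    (α : Fin n → Bool) :
    ∫⁻ x, ⨆ d, (gridCell α d).indicator (fun _ => (∏ i, cubeAvg (gridCell α d) (g i)) ^ q) x
        ∂(volume.withDensity (jointWeight q r ω)) ≤
      (2 ^ m) ^ q * apConst q r ω *
        ∏ i, (2 ^ r i * (2 * aInftyConst (dualWeight (r i) (ω i))) *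
          (C i ^ r i * ∫⁻ x, g i x ^ r i * ω i x)) ^ (q / r i) := by
  classical
  set σ : Fin m → Measure (EuclideanSpace ℝ (Fin n)) :=
    fun i => volume.withDensity (dualWeight (r i) (ω i)) with hσ
  set ν := volume.withDensity (jointWeight q r ω) with hν
  -- The dual weight is infinite where `ω i` vanishes, so local integrability makes `ω i` nonzero
  -- almost everywhere and `g i` may be divided by the dual weight.
  have hpos : ∀ i, ∀ᵐ x, ω i x ≠ 0 := by
    intro i
    obtain ⟨Q, hQ⟩ := exists_isCube n
    obtain ⟨R, hR, -, hU⟩ := hQ.exists_exhaustion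
    have : ∀ᵐ x ∂(volume.restrict (⋃ N, R N)), ω i x ≠ 0 := by
      rw [ae_restrict_iUnion_eq, Filter.eventually_iSup]
      intro N
      filter_upwards [ae_lt_top' (aemeasurable_dualWeight (hω i)).restrict (hloc (R N) (hR N) i)]
        with x hx using (dualWeight_ne_top_iff (hr i) x).1 hx.ne
    rwa [hU, Measure.restrict_univ] at this
  set h : Fin m → EuclideanSpace ℝ (Fin n) → ℝ≥0∞ :=
    fun i x => g i x / dualWeight (r i) (ω i) x with hh
  have hhm : ∀ i, AEMeasurable (h i) volume := fun i =>
    (hg i).div (aemeasurable_dualWeight (hω i))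
  have hσac : ∀ i, σ i ≪ volume := fun i => withDensity_absolutelyContinuous _ _
  have hdm : ∀ i, AEMeasurable (dualWeight (r i) (ω i)) volume :=
    fun i => aemeasurable_dualWeight (hω i)
  have hint : ∀ i Q, MeasurableSet Q →
      (σ i).withDensity (h i) Q = ∫⁻ x in Q, g i x := by
    intro i Q hQ
    rw [withDensity_apply _ hQ, hσ,
      restrict_withDensity hQ, lintegral_withDensity_eq_lintegral_mul₀ (hdm i).restrict
        (hhm i).restrict]
    refine lintegral_congr_ae (ae_restrict_of_ae ?_)
    filter_upwards [hpos i] with x hx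
    exact ENNReal.mul_div_cancel (dualWeight_ne_zero (hr i) x) ((dualWeight_ne_top_iff (hr i) x).2 hx)
  have hnorm : ∀ i, ∫⁻ x, h i x ^ r i ∂σ i = ∫⁻ x, g i x ^ r i * ω i x := by
    intro i
    rw [hσ, lintegral_withDensity_eq_lintegral_mul₀ (hdm i) ((hhm i).pow_const _)]
    refine lintegral_congr_ae ?_
    filter_upwards [hpos i] with x hx using dualWeight_rpow_mul (hr i) hx _
  have havg : ∀ d, avgProd volume (fun i => (σ i).withDensity (h i)) (gridCell α d)
      = ∏ i, cubeAvg (gridCell α d) (g i) := by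
    intro d
    simp only [avgProd, hint _ _ (measurableSet_gridCell α d), cubeAvg, Finset.prod_mul_distrib,
      Finset.prod_const, Finset.card_univ, Fintype.card_fin]
    rw [mul_comm, div_eq_mul_inv, ENNReal.inv_pow]
  have hσQ : ∀ i Q, MeasurableSet Q → σ i Q = ∫⁻ x in Q, dualWeight (r i) (ω i) x :=
    fun i Q hQ => withDensity_apply _ hQ
  -- Monotone convergence reduces the supremum over the grid to finite families of cells.
  simp_rw [iSup_eq_iSup_finset (fun d => (gridCell α d).indicator _ _)]
  rw [lintegral_iSup_directed]
  · refine iSup_le fun F => ?_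
    have hmem : ∀ Q ∈ F.image (gridCell α), ∃ d, gridCell α d = Q := fun Q hQ => by
      obtain ⟨d, -, h⟩ := Finset.mem_image.1 hQ
      exact ⟨d, h⟩
    have hv0 : ∀ d, volume (gridCell α d) ≠ 0 := fun d => by
      obtain ⟨R, hR, -, hae⟩ := exists_isCube_ae_eq_gridCell α d
      rw [measure_congr hae]; exact hR.volume_ne_zero
    have hvT : ∀ d, volume (gridCell α d) ≠ ∞ := fun d => by
      obtain ⟨R, hR, -, hae⟩ := exists_isCube_ae_eq_gridCell α d
      rw [measure_congr hae]; exact hR.volume_ne_top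
    have := lintegral_sup_avgProd_le hm (μ := volume) (ν := ν) (σ := σ) (h := h)
      (fun i => (hhm i).mono_ac (hσac i)) hr hC0 hC hq hqr (K := apConst q r ω)
      (Λ := fun i => aInftyConst (dualWeight (r i) (ω i)))
      (isLaminar_image_gridCell α F) ?_ ?_ ?_ ?_ ?_ ?_ ?_
    · simp_rw [hnorm] at this
      refine le_trans (lintegral_mono fun x => ?_) this
      rw [Finset.sup_image, ← Finset.sup_eq_iSup]
      refine Finset.sup_mono_fun fun d _ => ?_
      simp only [Function.comp, havg, le_refl]
    · intro Q hQ
      obtain ⟨d, rfl⟩ := hmem Q hQ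
      exact measurableSet_gridCell α d
    · intro Q hQ
      obtain ⟨d, rfl⟩ := hmem Q hQ
      exact hv0 d
    · intro Q hQ
      obtain ⟨d, rfl⟩ := hmem Q hQ
      exact hvT d
    · intro Q hQ i
      obtain ⟨d, rfl⟩ := hmem Q hQ
      rw [hσQ i _ (measurableSet_gridCell α d)]
      exact setLIntegral_dualWeight_ne_zero (hr i) (hω i) (hv0 d)
    · intro Q hQ i
      obtain ⟨d, rfl⟩ := hmem Q hQ
      obtain ⟨R, hR, hsub, hae⟩ := exists_isCube_ae_eq_gridCell α d
      rw [hσQ i _ (measurableSet_gridCell α d)]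
      exact ne_top_of_le_ne_top (hloc R hR i) (lintegral_mono_set hsub)
    · intro Q hQ
      obtain ⟨d, rfl⟩ := hmem Q hQ
      obtain ⟨R, hR, hsub, hae⟩ := exists_isCube_ae_eq_gridCell α d
      have e1 : ∀ i, σ i (gridCell α d) / volume (gridCell α d)
          = cubeAvg R (dualWeight (r i) (ω i)) := fun i => by
        rw [cubeAvg_eq_div, measure_congr hae, measure_congr ((hσac i).ae_eq hae),
          hσQ i R hR.measurableSet]
      have e2 : ν (gridCell α d) / volume (gridCell α d) = cubeAvg R (jointWeight q r ω) := by
        rw [cubeAvg_eq_div, measure_congr hae,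
          measure_congr ((withDensity_absolutelyContinuous _ _).ae_eq hae),
          withDensity_apply _ hR.measurableSet]
      simp_rw [e1, e2]
      exact le_iSup₂ (f := fun (Q : Set (EuclideanSpace ℝ (Fin n))) (_ : IsCube Q) =>
        (∏ i, cubeAvg Q (dualWeight (r i) (ω i)) ^ (q / Real.conjExponent (r i))) *
        cubeAvg Q (jointWeight q r ω)) R hR
    · intro Q hQ i
      obtain ⟨d, rfl⟩ := hmem Q hQ
      obtain ⟨R, hR, hsub, hae⟩ := exists_isCube_ae_eq_gridCell α d
      -- The averages over smaller cells are averages over closed cubes of the weight cut off to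
      -- `R`, hence at most its maximal function; the `A_∞` constant bounds the integral over `R`.
      refine ⟨hlMaximal (R.indicator (dualWeight (r i) (ω i))), ?_, ?_⟩
      · intro Q' hQ' hQQ x hx
        obtain ⟨d', rfl⟩ := hmem Q' hQ'
        obtain ⟨R', hR', hsub', hae'⟩ := exists_isCube_ae_eq_gridCell α d'
        have : σ i (gridCell α d') / volume (gridCell α d')
            = cubeAvg R' (R.indicator (dualWeight (r i) (ω i))) := by
          rw [cubeAvg_eq_div, measure_congr hae', setLIntegral_congr hae'.symm,
            hσQ i _ (measurableSet_gridCell α d')]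
          congr 1
          refine setLIntegral_congr_fun (measurableSet_gridCell α d') fun y hy => ?_
          rw [Set.indicator_of_mem (hsub (hQQ hy))]
        rw [this]
        exact le_iSup_of_le R' (le_iSup₂_of_le hR' (hsub' hx) le_rfl)
      · have hσR : σ i (gridCell α d) = ∫⁻ x in R, dualWeight (r i) (ω i) x := by
          rw [hσQ i _ (measurableSet_gridCell α d), setLIntegral_congr hae]
        rw [hσR]
        have h0 := setLIntegral_dualWeight_ne_zero (hr i) (hω i) hR.volume_ne_zero
        refine (lintegral_mono_set hsub).trans ((ENNReal.div_le_iff h0 (hloc R hR i)).1 ?_)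
        exact le_iSup₂ (f := fun (Q : Set (EuclideanSpace ℝ (Fin n))) (_ : IsCube Q) =>
          (∫⁻ x in Q, hlMaximal (Q.indicator (dualWeight (r i) (ω i))) x) /
            ∫⁻ x in Q, dualWeight (r i) (ω i) x) R hR
  · intro F
    refine Measurable.aemeasurable ?_
    refine Measurable.iSup fun d => Measurable.iSup fun _ => ?_
    exact measurable_const.indicator (measurableSet_gridCell α d)
  · refine Monotone.directed_le fun F G hFG x => ?_
    exact biSup_mono fun d hd => hFG hd

/-- The sharp mixed `A_P`-`A_∞` bound for the multilinear maximal operator, stated through a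
measurable majorant. -/
theorem exists_multilinearMaximal_majorant (n : ℕ) {m : ℕ} (hm : 0 < m) {q : ℝ} {r : Fin m → ℝ}
    (hr : ∀ i, 1 < r i) (hq : 0 < q) (hqr : ∑ i, q / r i = 1) :
    ∃ C : ℝ≥0∞, C ≠ ∞ ∧ ∀ (ω : Fin m → EuclideanSpace ℝ (Fin n) → ℝ≥0)
      (g : Fin m → EuclideanSpace ℝ (Fin n) → ℝ≥0∞), (∀ i, AEMeasurable (ω i) volume) →
      (∀ i, AEMeasurable (g i) volume) → apConst q r ω < ∞ →
      ∃ B : EuclideanSpace ℝ (Fin n) → ℝ≥0∞, Measurable B ∧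
        (∀ Q, IsCube Q → ∀ x ∈ Q, (∏ i, cubeAvg Q (g i)) ^ q ≤ B x) ∧
        ∫⁻ x, B x ∂(volume.withDensity (jointWeight q r ω)) ≤
          C * apConst q r ω * (∏ i, aInftyConst (dualWeight (r i) (ω i)) ^ (q / r i)) *
            ∏ i, (∫⁻ x, g i x ^ r i * ω i x) ^ (q / r i) := by
  choose C hC0 hC using fun i => exists_geometric_const (hr i)
  have hr0 : ∀ i, 0 < r i := fun i => by linarith [hr i]
  have hqr0 : ∀ i, 0 ≤ q / r i := fun i => div_nonneg hq.le (hr0 i).le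
  -- `D₁` is the loss in enlarging a cube to a grid cell, `2 ^ n` counts the grids, and the
  -- remaining factors come from the bound on one grid.
  set D₁ : ℝ≥0∞ := ((6 ^ n) ^ m) ^ q with hD₁
  set D₂ : ℝ≥0∞ := ∏ i, (2 ^ r i * 2 * (C i : ℝ≥0∞) ^ r i) ^ (q / r i) with hD₂
  refine ⟨D₁ * (2 ^ n * ((2 ^ m) ^ q * D₂)), ?_, fun ω g hω hg hap => ?_⟩
  · refine ENNReal.mul_ne_top (ENNReal.rpow_ne_top_of_nonneg hq.le (by finiteness))
      (ENNReal.mul_ne_top (by finiteness) (ENNReal.mul_ne_top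
        (ENNReal.rpow_ne_top_of_nonneg hq.le (by finiteness)) (ENNReal.prod_ne_top fun i _ =>
          ENNReal.rpow_ne_top_of_nonneg (hqr0 i) (ENNReal.mul_ne_top (ENNReal.mul_ne_top
            (ENNReal.rpow_ne_top_of_nonneg (hr0 i).le (by finiteness)) (by finiteness))
            (ENNReal.rpow_ne_top_of_nonneg (hr0 i).le ENNReal.coe_ne_top)))))
  set φ : (Fin n → Bool) → EuclideanSpace ℝ (Fin n) → ℝ≥0∞ := fun α x =>
    ⨆ d, (gridCell α d).indicator (fun _ => (∏ i, cubeAvg (gridCell α d) (g i)) ^ q) x with hφ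
  have hφm : ∀ α, Measurable (φ α) := fun α => Measurable.iSup fun d =>
    measurable_const.indicator (measurableSet_gridCell α d)
  refine ⟨fun x => D₁ * ∑ α, φ α x, (Finset.measurable_fun_sum _ fun α _ => hφm α).const_mul _,
    fun Q hQ x hx => ?_, ?_⟩
  · obtain ⟨α, d, hsub, hvol⟩ := hQ.exists_subset_gridCell
    have h1 : ∀ i, cubeAvg Q (g i) ≤ 6 ^ n * cubeAvg (gridCell α d) (g i) := by
      intro i
      have hinv : (volume Q)⁻¹ ≤ 6 ^ n * (volume (gridCell α d))⁻¹ := by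
        rw [← div_eq_mul_inv, ENNReal.le_div_iff_mul_le (Or.inr (by positivity))
          (Or.inr (by finiteness)), mul_comm, ← div_eq_mul_inv]
        exact ENNReal.div_le_of_le_mul hvol
      rw [cubeAvg, cubeAvg, ← mul_assoc]
      gcongr
    calc (∏ i, cubeAvg Q (g i)) ^ q
        ≤ (∏ i, 6 ^ n * cubeAvg (gridCell α d) (g i)) ^ q := by
          gcongr with i
          exact h1 i
      _ = D₁ * (∏ i, cubeAvg (gridCell α d) (g i)) ^ q := by
          rw [Finset.prod_mul_distrib, ENNReal.mul_rpow_of_nonneg _ _ hq.le]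
          simp [hD₁]
      _ ≤ D₁ * φ α x := by
          gcongr
          refine le_trans ?_ (le_iSup _ d)
          rw [Set.indicator_of_mem (hsub hx)]
      _ ≤ D₁ * ∑ α, φ α x := by
          gcongr
          exact Finset.single_le_sum (f := fun α => φ α x) (fun _ _ => zero_le)
            (Finset.mem_univ α)
  · by_cases hloc : ∀ Q : Set (EuclideanSpace ℝ (Fin n)), IsCube Q → ∀ i,
      ∫⁻ x in Q, dualWeight (r i) (ω i) x ≠ ∞
    · rw [lintegral_const_mul _ (Finset.measurable_fun_sum _ fun α _ => hφm α),
        lintegral_finsetSum _ fun α _ => hφm α]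
      calc _ ≤ D₁ * ∑ _α : Fin n → Bool, (2 ^ m) ^ q * apConst q r ω *
            ∏ i, (2 ^ r i * (2 * aInftyConst (dualWeight (r i) (ω i))) *
              (C i ^ r i * ∫⁻ x, g i x ^ r i * ω i x)) ^ (q / r i) := by
            gcongr with α
            exact lintegral_iSup_gridCell_le hm hr (fun i => by simpa using hC0 i) hC hq hqr hω
              hloc hg α
        _ = _ := by
            rw [Finset.sum_const, Finset.card_univ, Fintype.card_fun, Fintype.card_bool,
              Fintype.card_fin, nsmul_eq_mul]
            have e : ∀ i, 2 ^ r i * (2 * aInftyConst (dualWeight (r i) (ω i))) *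
              (C i ^ r i * ∫⁻ x, g i x ^ r i * ω i x) = (2 ^ r i * 2 * (C i : ℝ≥0∞) ^ r i) *
                aInftyConst (dualWeight (r i) (ω i)) * ∫⁻ x, g i x ^ r i * ω i x := fun i => by
              ring
            simp_rw [e, ENNReal.mul_rpow_of_nonneg _ _ (hqr0 _), Finset.prod_mul_distrib]
            simp only [hD₂, ENNReal.mul_rpow_of_nonneg _ _ (hqr0 _), Finset.prod_mul_distrib]
            push_cast
            ring
    -- If some dual weight is not locally integrable, the joint measure is zero and nothing is left
    -- to estimate.
    · push Not at hloc
      obtain ⟨Q, hQ, i, hi⟩ := hloc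
      rw [withDensity_jointWeight_eq_zero hr hq hω hap hQ hi]
      simp

end

/-! ### From the rough operator to the multilinear maximal function. -/

theorem lintegral_pi_prod_eq_prod_lintegral {X : Type*} [MeasurableSpace X] {m : ℕ}
    (μ : Fin m → Measure X) [∀ i, SigmaFinite (μ i)] {f : Fin m → X → ℝ≥0∞}
    (hf : ∀ i, AEMeasurable (f i) (μ i)) :
    ∫⁻ y, ∏ i, f i (y i) ∂(Measure.pi μ) = ∏ i, ∫⁻ x, f i x ∂(μ i) := by
  induction m with
  | zero => simp
  | succ m ih =>
    have hmp := measurePreserving_piFinSuccAbove μ 0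
    have h1 := hmp.lintegral_map_equiv
      (fun z : X × (Fin m → X) => f 0 z.1 * ∏ i : Fin m, f i.succ (z.2 i))
    have hrest : AEMeasurable (fun y : Fin m → X => ∏ i : Fin m, f i.succ (y i))
        (Measure.pi fun i : Fin m => μ i.succ) := by
      refine Finset.aemeasurable_fun_prod _ fun i _ => ?_
      exact (hf i.succ).comp_quasiMeasurePreserving
        (Measure.quasiMeasurePreserving_eval (fun i : Fin m => μ i.succ) i)
    rw [Fin.prod_univ_succ, ← ih (fun i => μ i.succ) (fun i => hf i.succ),
      ← lintegral_prod_mul (hf 0) hrest]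
    simp only [Fin.prod_univ_succ]
    exact h1.symm

theorem IsCube.norm_sub_lt {n : ℕ} {a x y : EuclideanSpace ℝ (Fin n)} {l : ℝ} (hl : 0 < l)
    (hx : ∀ j, a j ≤ x j ∧ x j ≤ a j + l) (hy : ∀ j, a j ≤ y j ∧ y j ≤ a j + l) :
    ‖x - y‖ < (n + 1) * l := by
  have h1 : ∀ j, ‖(x - y) j‖ ≤ l := fun j => by
    rw [PiLp.sub_apply, Real.norm_eq_abs, abs_le]
    constructor <;> linarith [(hx j).1, (hx j).2, (hy j).1, (hy j).2]
  have h2 : ‖x - y‖ ^ 2 ≤ n * l ^ 2 := by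
    rw [EuclideanSpace.norm_sq_eq]
    calc ∑ j, ‖(x - y) j‖ ^ 2 ≤ ∑ _j : Fin n, l ^ 2 :=
          Finset.sum_le_sum fun j _ => by gcongr; exact h1 j
      _ = n * l ^ 2 := by simp
  refine lt_of_pow_lt_pow_left₀ 2 (by positivity) (h2.trans_lt ?_)
  have hn : (0 : ℝ) ≤ n := by positivity
  rw [mul_pow]
  exact mul_lt_mul_of_pos_right (by nlinarith) (by positivity)

section
variable {n m : ℕ} {s : ℝ≥0∞} {s' : ℝ} {Ω : (Fin m → EuclideanSpace ℝ (Fin n)) → ℂ}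

/-- `L^s` control of a kernel on products of balls, with the scaling of a function that is
homogeneous of degree zero. -/
structure HasBallBound (Ω : (Fin m → EuclideanSpace ℝ (Fin n)) → ℂ) (s : ℝ≥0∞) (c N : ℝ≥0∞) :
    Prop where
  aestronglyMeasurable : ∀ R : ℝ, 0 < R → AEStronglyMeasurable Ω
    (volume.restrict (Set.univ.pi fun _ : Fin m => Metric.ball (0 : EuclideanSpace ℝ (Fin n)) R))
  eLpNorm_le : ∀ R : ℝ, 0 < R → eLpNorm Ω s
    (volume.restrict (Set.univ.pi fun _ : Fin m => Metric.ball (0 : EuclideanSpace ℝ (Fin n)) R))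
    ≤ (c * ENNReal.ofReal R ^ (n * m)) ^ (1 / s).toReal * N

theorem toReal_one_div_add (hs' : 1 ≤ s') (hs : s.HolderConjugate (ENNReal.ofReal s')) :
    (1 / s).toReal + 1 / s' = 1 := by
  have h := hs.inv_add_inv_eq_inv
  have hs0 : 0 < s' := by linarith
  have h1 : s⁻¹ ≠ ∞ := fun h' => by simp [h'] at h
  have h2 : (ENNReal.ofReal s')⁻¹ ≠ ∞ := by simpa using hs0
  have := congrArg ENNReal.toReal h
  rw [ENNReal.toReal_add h1 h2, inv_one, ENNReal.toReal_one, ENNReal.toReal_inv (ENNReal.ofReal s'),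
    ENNReal.toReal_ofReal hs0.le] at this
  rw [one_div, one_div, this]

/-- Hölder on `Q^m`. The map `y ↦ x - y` sends `Q^m` into the product of balls of radius `(n+1)l`,
so the kernel contributes `|Q|^{m/s}`. Against `|Q|^{-m}` this leaves `|Q|^{-m/s'}`, exactly the
normalization of the averages of `|f i|^{s'}`. -/
theorem HasBallBound.cube_average_le {c N : ℝ≥0∞} (hΩ : HasBallBound Ω s c N) (hs' : 1 ≤ s')
    (hs : s.HolderConjugate (ENNReal.ofReal s'))
    {f : Fin m → EuclideanSpace ℝ (Fin n) → ℂ} (hf : ∀ i, AEStronglyMeasurable (f i) volume)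
    {Q : Set (EuclideanSpace ℝ (Fin n))} (hQ : IsCube Q) {x : EuclideanSpace ℝ (Fin n)}
    (hx : x ∈ Q) :
    (volume Q ^ m)⁻¹ *
        ∫⁻ y in Set.univ.pi (fun _ : Fin m => Q), ‖Ω (fun i => x - y i)‖ₑ * ∏ i, ‖f i (y i)‖ₑ ≤
      (c * (n + 1) ^ (n * m)) ^ (1 / s).toReal * N *
        (∏ i, cubeAvg Q (fun z => ‖f i z‖ₑ ^ s')) ^ (1 / s') := by
  have hs0 : 0 < s' := by linarith
  have hQm := hQ.measurableSet
  have hV0 := hQ.volume_ne_zero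
  have hVT := hQ.volume_ne_top
  obtain ⟨a, l, hl, hQe⟩ := hQ
  set R : ℝ := (n + 1) * l with hR
  have hR0 : 0 < R := by positivity
  set U : Set (Fin m → EuclideanSpace ℝ (Fin n)) := Set.univ.pi fun _ => Metric.ball 0 R with hU
  set QQ : Set (Fin m → EuclideanSpace ℝ (Fin n)) := Set.univ.pi fun _ => Q with hQQ
  have hUm : MeasurableSet U := MeasurableSet.univ_pi fun _ => Metric.isOpen_ball.measurableSet
  set τ : (Fin m → EuclideanSpace ℝ (Fin n)) → (Fin m → EuclideanSpace ℝ (Fin n)) :=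
    fun y => (fun _ => x) - y with hτ
  have hneg : (volume : Measure (Fin m → EuclideanSpace ℝ (Fin n))).IsNegInvariant :=
    Measure.pi.isNegInvariant _
  have hτm : MeasurePreserving τ volume volume := Measure.measurePreserving_sub_left volume _
  have hsub : QQ ⊆ τ ⁻¹' U := by
    intro y hy i _
    rw [mem_ball_zero_iff]
    have hyi : y i ∈ Q := hy i (Set.mem_univ i)
    rw [hQe] at hyi hx
    exact IsCube.norm_sub_lt hl hx hyi
  have hτr : MeasurePreserving τ (volume.restrict (τ ⁻¹' U)) (volume.restrict U) :=
    hτm.restrict_preimage hUm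
  have hΩτ : AEStronglyMeasurable (Ω ∘ τ) (volume.restrict QQ) :=
    ((hΩ.aestronglyMeasurable R hR0).comp_measurePreserving hτr).mono_measure
      (Measure.restrict_mono hsub le_rfl)
  have hΩn : eLpNorm (Ω ∘ τ) s (volume.restrict QQ) ≤
      (c * ENNReal.ofReal R ^ (n * m)) ^ (1 / s).toReal * N := by
    refine (eLpNorm_mono_measure _ (Measure.restrict_mono hsub le_rfl)).trans ?_
    rw [eLpNorm_comp_measurePreserving (hΩ.aestronglyMeasurable R hR0) hτr]
    exact hΩ.eLpNorm_le R hR0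
  have hQQr : (volume : Measure (Fin m → EuclideanSpace ℝ (Fin n))).restrict QQ
      = Measure.pi fun _ => volume.restrict Q := Measure.restrict_pi_pi _ _
  set G : (Fin m → EuclideanSpace ℝ (Fin n)) → ℂ := fun y => ∏ i, f i (y i) with hG
  have hGm : AEStronglyMeasurable G (volume.restrict QQ) := by
    rw [hQQr]
    refine Finset.aestronglyMeasurable_fun_prod _ fun i _ => ?_
    exact (hf i).restrict.comp_quasiMeasurePreserving (Measure.quasiMeasurePreserving_eval _ i)
  have henorm : ∀ y, ‖G y‖ₑ = ∏ i, ‖f i (y i)‖ₑ := fun y => by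
    simp only [hG, enorm_eq_nnnorm, nnnorm_prod, ENNReal.ofNNReal_finsetProd]
  have hGn : eLpNorm G (ENNReal.ofReal s') (volume.restrict QQ)
      = (∏ i, ∫⁻ z in Q, ‖f i z‖ₑ ^ s') ^ (1 / s') := by
    rw [eLpNorm_eq_lintegral_rpow_enorm_toReal (by simpa using hs0) ENNReal.ofReal_ne_top,
      ENNReal.toReal_ofReal hs0.le]
    simp_rw [henorm, ← ENNReal.prod_rpow_of_nonneg hs0.le]
    rw [hQQr, lintegral_pi_prod_eq_prod_lintegral (f := fun i z => ‖f i z‖ₑ ^ s') _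
      fun i => ((hf i).restrict.enorm.pow_const _)]
  have hholder : ∫⁻ y in QQ, ‖Ω (fun i => x - y i)‖ₑ * ∏ i, ‖f i (y i)‖ₑ ≤
      (c * ENNReal.ofReal R ^ (n * m)) ^ (1 / s).toReal * N *
        (∏ i, ∫⁻ z in Q, ‖f i z‖ₑ ^ s') ^ (1 / s') := by
    have h := eLpNorm_smul_le_mul_eLpNorm hGm hΩτ (p := s) (q := ENNReal.ofReal s') (r := 1)
    rw [eLpNorm_one_eq_lintegral_enorm, hGn] at h
    refine le_trans (le_of_eq ?_) (h.trans (by gcongr))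
    refine lintegral_congr fun y => ?_
    rw [Pi.smul_apply', smul_eq_mul, enorm_mul, henorm]
    rfl
  have hconj := toReal_one_div_add hs' hs
  set b := (1 / s).toReal with hb
  have hb0 : 0 ≤ b := ENNReal.toReal_nonneg
  have hVm0 : volume Q ^ m ≠ 0 := pow_ne_zero _ hV0
  have hVmT : volume Q ^ m ≠ ∞ := ENNReal.pow_ne_top hVT
  have hRV : ENNReal.ofReal R ^ (n * m) = (n + 1) ^ (n * m) * volume Q ^ m := by
    rw [hQe, volume_closedCube, ← pow_mul, ← mul_pow, hR, ENNReal.ofReal_mul (by positivity)]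
    congr 2
    rw [ENNReal.ofReal_add (by positivity) (by norm_num)]
    simp
  have havg : ∏ i, cubeAvg Q (fun z => ‖f i z‖ₑ ^ s')
      = (volume Q ^ m)⁻¹ * ∏ i, ∫⁻ z in Q, ‖f i z‖ₑ ^ s' := by
    simp [cubeAvg, Finset.prod_mul_distrib, ENNReal.inv_pow]
  have hVsplit : (volume Q ^ m) ^ b * (volume Q ^ m) ^ (1 / s') = volume Q ^ m := by
    rw [← ENNReal.rpow_add _ _ hVm0 hVmT, hconj, ENNReal.rpow_one]
  have hcancel : (volume Q ^ m)⁻¹ * (volume Q ^ m) ^ b = ((volume Q ^ m)⁻¹) ^ (1 / s') := by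
    conv_lhs => rw [← ENNReal.rpow_neg_one, ← ENNReal.rpow_add _ _ hVm0 hVmT]
    rw [ENNReal.inv_rpow, ← ENNReal.rpow_neg]
    congr 1
    linarith
  rw [havg, ENNReal.mul_rpow_of_nonneg _ _ (by positivity : 0 ≤ 1 / s'), ← hcancel]
  rw [hRV, ← mul_assoc, ENNReal.mul_rpow_of_nonneg _ _ hb0] at hholder
  calc _ ≤ (volume Q ^ m)⁻¹ * ((c * (n + 1) ^ (n * m)) ^ b * (volume Q ^ m) ^ b * N *
        (∏ i, ∫⁻ z in Q, ‖f i z‖ₑ ^ s') ^ (1 / s')) := by gcongr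
    _ = _ := by ring

/-- The weighted bound for the rough maximal operator, for every kernel with a ball bound. -/
theorem exists_weightedNorm_roughMaximal_le (n : ℕ) {m : ℕ} (hm : 0 < m) (s : ℝ≥0∞) {s' : ℝ}
    (hs' : 1 ≤ s') (hs : s.HolderConjugate (ENNReal.ofReal s')) {P : Fin m → ℝ}
    (hP : ∀ i, s' < P i) {p : ℝ} (hp : 1 / p = ∑ i, 1 / P i) {c : ℝ≥0∞} (hc : c ≠ ∞) :
    ∃ C : ℝ≥0, ∀ (ω : Fin m → EuclideanSpace ℝ (Fin n) → ℝ≥0)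
      (f : Fin m → EuclideanSpace ℝ (Fin n) → ℂ)
      (Ω : (Fin m → EuclideanSpace ℝ (Fin n)) → ℂ) (N : ℝ≥0∞), HasBallBound Ω s c N →
      (∀ i, AEMeasurable (ω i) volume) → (∀ i, AEStronglyMeasurable (f i) volume) →
      apConst (p / s') (fun i => P i / s') ω < ∞ →
      weightedNorm (roughMaximal Ω f) p (jointWeight p P ω) ≤
        C * N * apConst (p / s') (fun i => P i / s') ω ^ (1 / p) *
          (∏ i, aInftyConst (dualWeight (P i / s') (ω i)) ^ (1 / P i)) *
          ∏ i, weightedNorm (f i) (P i) (fun x => (ω i x : ℝ≥0∞)) := by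
  have hs0 : 0 < s' := by linarith
  have hP0 : ∀ i, 0 < P i := fun i => hs0.trans (hP i)
  have hp0 : 0 < p := by
    have : 0 < 1 / p := by
      rw [hp]
      exact Finset.sum_pos (fun i _ => one_div_pos.2 (hP0 i)) ⟨⟨0, hm⟩, Finset.mem_univ _⟩
    exact one_div_pos.1 this
  have hq : 0 < p / s' := by positivity
  have hratio : ∀ i, p / s' / (P i / s') = p / P i := fun i => by
    have := (hP0 i).ne'
    field_simp
  have hqr : ∑ i, p / s' / (P i / s') = 1 := by
    simp_rw [hratio, div_eq_mul_one_div p, ← Finset.mul_sum, ← hp]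
    field_simp
  obtain ⟨C, hCT, hC⟩ := exists_multilinearMaximal_majorant n hm
    (r := fun i => P i / s') (fun i => (one_lt_div hs0).2 (hP i)) hq hqr
  set D : ℝ≥0∞ := (c * (n + 1) ^ (n * m)) ^ (1 / s).toReal with hD
  have hDT : D ≠ ∞ := ENNReal.rpow_ne_top_of_nonneg ENNReal.toReal_nonneg
    (ENNReal.mul_ne_top hc (by finiteness))
  have hCp : C ^ (1 / p) ≠ ∞ := ENNReal.rpow_ne_top_of_nonneg (by positivity) hCT
  refine ⟨(D * C ^ (1 / p)).toNNReal, fun ω f Ω N hΩ hω hf hap => ?_⟩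
  rw [ENNReal.coe_toNNReal (ENNReal.mul_ne_top hDT hCp)]
  obtain ⟨B, hBm, hBQ, hBint⟩ := hC ω (fun i z => ‖f i z‖ₑ ^ s') hω
    (fun i => (hf i).enorm.pow_const _) hap
  -- The joint weight depends only on the ratios `p / P i`, which rescaling by `s'` preserves.
  have hjoint : jointWeight (p / s') (fun i => P i / s') ω = jointWeight p P ω := by
    funext x
    simp only [jointWeight, hratio]
  rw [hjoint] at hBint
  have hpt : ∀ x, roughMaximal Ω f x ≤ D * N * B x ^ (1 / p) := by
    intro x
    refine iSup_le fun Q => iSup_le fun hQ => iSup_le fun hx => ?_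
    refine (hΩ.cube_average_le hs' hs hf hQ hx).trans ?_
    gcongr
    have h1 := ENNReal.rpow_le_rpow (hBQ Q hQ x hx) (by positivity : 0 ≤ 1 / p)
    rwa [← ENNReal.rpow_mul, div_mul_div_comm, mul_one, mul_comm s', ← div_div,
      div_self hp0.ne'] at h1
  have hnorm : ∀ i, (∫⁻ x, (‖f i x‖ₑ ^ s') ^ (P i / s') * ω i x) ^ (1 / P i)
      = weightedNorm (f i) (P i) (fun x => (ω i x : ℝ≥0∞)) := by
    intro i
    rw [weightedNorm, eLpNorm_eq_lintegral_rpow_enorm_toReal (by simpa using hP0 i)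
      ENNReal.ofReal_ne_top, ENNReal.toReal_ofReal (hP0 i).le,
      lintegral_withDensity_eq_lintegral_mul₀ (hω i).coe_nnreal_ennreal
        ((hf i).enorm.pow_const _)]
    congr 1
    refine lintegral_congr fun x => ?_
    rw [← ENNReal.rpow_mul, mul_div_cancel₀ _ hs0.ne', Pi.mul_apply, mul_comm]
  calc weightedNorm (roughMaximal Ω f) p (jointWeight p P ω)
      = (∫⁻ x, roughMaximal Ω f x ^ p ∂(volume.withDensity (jointWeight p P ω))) ^ (1 / p) := by
        rw [weightedNorm, eLpNorm_eq_lintegral_rpow_enorm_toReal (by simpa using hp0)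
          ENNReal.ofReal_ne_top, ENNReal.toReal_ofReal hp0.le]
        rfl
    _ ≤ (∫⁻ x, (D * N) ^ p * B x ∂(volume.withDensity (jointWeight p P ω))) ^ (1 / p) := by
        refine ENNReal.rpow_le_rpow (lintegral_mono fun x => ?_) (by positivity)
        refine (ENNReal.rpow_le_rpow (hpt x) hp0.le).trans (le_of_eq ?_)
        rw [ENNReal.mul_rpow_of_nonneg _ _ hp0.le, ← ENNReal.rpow_mul, one_div,
          inv_mul_cancel₀ hp0.ne', ENNReal.rpow_one]
    _ = D * N * (∫⁻ x, B x ∂(volume.withDensity (jointWeight p P ω))) ^ (1 / p) := by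
        rw [lintegral_const_mul _ hBm, ENNReal.mul_rpow_of_nonneg _ _ (by positivity),
          ← ENNReal.rpow_mul, mul_one_div_cancel hp0.ne', ENNReal.rpow_one]
    _ ≤ D * N * (C * apConst (p / s') (fun i => P i / s') ω *
          (∏ i, aInftyConst (dualWeight (P i / s') (ω i)) ^ (p / s' / (P i / s'))) *
          ∏ i, (∫⁻ x, (‖f i x‖ₑ ^ s') ^ (P i / s') * ω i x) ^ (p / s' / (P i / s'))) ^ (1 / p) := by
        gcongr
    _ = _ := by
        have hexp : ∀ i, p / P i * (1 / p) = 1 / P i := fun i => by field_simp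
        simp_rw [ENNReal.mul_rpow_of_nonneg _ _ (one_div_nonneg.2 hp0.le),
          ← ENNReal.prod_rpow_of_nonneg (one_div_nonneg.2 hp0.le), ← ENNReal.rpow_mul, hratio,
          hexp]
        simp_rw [ENNReal.rpow_mul, hnorm]
        ring

end

/-! ### Polar coordinates and `L^s` bounds for homogeneous kernels. -/

section
variable {E : Type*} [NormedAddCommGroup E] [NormedSpace ℝ E]

open Classical in
/-- The radial projection to the unit sphere; its value at `0` is arbitrary. -/
noncomputable def sphereProj (e : Metric.sphere (0 : E) 1) (x : E) : Metric.sphere (0 : E) 1 :=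
  ⟨if x = 0 then e else ‖x‖⁻¹ • x, by
    split_ifs with h
    · exact e.2
    · rw [mem_sphere_zero_iff_norm, norm_smul, norm_inv, norm_norm,
        inv_mul_cancel₀ (norm_ne_zero_iff.2 h)]⟩

theorem coe_sphereProj (e : Metric.sphere (0 : E) 1) {x : E} (hx : x ≠ 0) :
    (sphereProj e x : E) = ‖x‖⁻¹ • x := if_neg hx

variable [MeasurableSpace E] [BorelSpace E]

theorem measurable_sphereProj [SecondCountableTopology E] (e : Metric.sphere (0 : E) 1) :
    Measurable (sphereProj e) := by
  classical
  refine Measurable.subtype_mk (Measurable.ite (measurableSet_singleton 0) measurable_const ?_)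
  fun_prop

open scoped Pointwise in
-- Off the origin, the part of the ball projecting into `S` is `R • ((0,1) • S)`. The surface
-- measure of `S` is the dimension `d` times the measure of `(0,1) • S`, and dilation by `R`
-- contributes `R^d`.
theorem map_sphereProj_restrict_ball [FiniteDimensional ℝ E] [Nontrivial E] (μ : Measure E)
    [μ.IsAddHaarMeasure] (e : Metric.sphere (0 : E) 1) {R : ℝ} (hR : 0 < R) :
    (μ.restrict (Metric.ball 0 R)).map (sphereProj e) =
      (ENNReal.ofReal R ^ Module.finrank ℝ E * (Module.finrank ℝ E : ℝ≥0∞)⁻¹) • μ.toSphere := by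
  have : ProperSpace E := FiniteDimensional.proper ℝ E
  ext S hS
  have hd : (Module.finrank ℝ E : ℝ≥0∞) ≠ 0 := by
    simpa using Module.finrank_pos.ne'
  rw [Measure.map_apply (measurable_sphereProj e) hS,
    Measure.restrict_apply (measurable_sphereProj e hS), Measure.smul_apply, smul_eq_mul,
    Measure.toSphere_apply' μ hS]
  have hset : (sphereProj e ⁻¹' S ∩ Metric.ball 0 R) \ {0}
      = R • (Set.Ioo (0 : ℝ) 1 • ((↑) '' S : Set E)) := by
    ext x
    simp only [Set.mem_sdiff, Set.mem_inter_iff, Set.mem_preimage, mem_ball_zero_iff,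
      Set.mem_singleton_iff]
    constructor
    · rintro ⟨⟨hxS, hxR⟩, hx0⟩
      have hxn := norm_pos_iff.2 hx0
      refine Set.mem_smul_set.2 ⟨R⁻¹ • x, Set.mem_smul.2 ⟨‖x‖ / R, ⟨by positivity,
        (div_lt_one hR).2 hxR⟩, _, ⟨_, hxS, rfl⟩, ?_⟩, smul_inv_smul₀ hR.ne' x⟩
      rw [coe_sphereProj e hx0, smul_smul]
      congr 1
      field_simp
    · intro hx
      obtain ⟨y, hy, rfl⟩ := Set.mem_smul_set.1 hx
      obtain ⟨t, ⟨ht0, ht1⟩, -, ⟨θ, hθ, rfl⟩, rfl⟩ := Set.mem_smul.1 hy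
      have hθn : ‖(θ : E)‖ = 1 := mem_sphere_zero_iff_norm.1 θ.2
      have hnorm : ‖R • t • (θ : E)‖ = R * t := by
        rw [norm_smul, norm_smul, hθn, mul_one, Real.norm_of_nonneg hR.le,
          Real.norm_of_nonneg ht0.le]
      have hne : R • t • (θ : E) ≠ 0 := by
        rw [← norm_pos_iff, hnorm]; positivity
      refine ⟨⟨?_, ?_⟩, hne⟩
      · have : sphereProj e (R • t • (θ : E)) = θ := by
          apply Subtype.ext
          rw [coe_sphereProj e hne, hnorm, smul_smul, smul_smul]
          have : (R * t)⁻¹ * (R * t) = 1 := inv_mul_cancel₀ (by positivity)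
          rw [mul_assoc, this, one_smul]
        rwa [this]
      · rw [hnorm]; nlinarith
  rw [← measure_sdiff_null (measure_singleton (0 : E)), hset, Measure.addHaar_smul,
    abs_of_nonneg (by positivity), ENNReal.ofReal_pow hR.le]
  rw [mul_assoc, ← mul_assoc _ (Module.finrank ℝ E : ℝ≥0∞), ENNReal.inv_mul_cancel hd (by finiteness),
    one_mul]

end

/-- Transfers a norm on the sphere to the ball. Domination of the image measure suffices, which
matters for `S^{mn-1}`, where a product of balls is only contained in a ball. -/
theorem eLpNorm_le_of_ae_eq_comp {Y Z : Type*} [MeasurableSpace Y] [MeasurableSpace Z]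
    {ρ : Measure Y} {τ : Measure Z} {θ : Y → Z} (hθ : Measurable θ) {c : ℝ≥0∞}
    (hmap : ρ.map θ ≤ c • τ) {s : ℝ≥0∞} {Ψ : Z → ℂ} (hΨ : AEStronglyMeasurable Ψ τ) {Ω : Y → ℂ}
    (hΩ : Ω =ᵐ[ρ] Ψ ∘ θ) :
    AEStronglyMeasurable Ω ρ ∧ eLpNorm Ω s ρ ≤ c ^ (1 / s).toReal * eLpNorm Ψ s τ := by
  have h1 : AEStronglyMeasurable Ψ (ρ.map θ) :=
    hΨ.mono_ac (Measure.absolutelyContinuous_of_le_smul hmap)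
  refine ⟨(h1.comp_measurable hθ).congr hΩ.symm, ?_⟩
  rw [eLpNorm_congr_ae hΩ, ← eLpNorm_map_measure h1 hθ.aemeasurable]
  exact eLpNorm_le_of_measure_le_smul hmap

theorem HasBallBound.of_forall {n m : ℕ} {Ω : (Fin m → EuclideanSpace ℝ (Fin n)) → ℂ}
    {s c N : ℝ≥0∞}
    (h : ∀ R : ℝ, 0 < R → AEStronglyMeasurable Ω (volume.restrict
        (Set.univ.pi fun _ : Fin m => Metric.ball (0 : EuclideanSpace ℝ (Fin n)) R)) ∧
      eLpNorm Ω s (volume.restrict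
        (Set.univ.pi fun _ : Fin m => Metric.ball (0 : EuclideanSpace ℝ (Fin n)) R)) ≤
        (c * ENNReal.ofReal R ^ (n * m)) ^ (1 / s).toReal * N) : HasBallBound Ω s c N :=
  ⟨fun R hR => (h R hR).1, fun R hR => (h R hR).2⟩

/-- Projecting each variable separately sends the product of balls to the product of spheres, each
factor contributing `R^n / n`. Almost everywhere no `y i` vanishes, so separate homogeneity applies.
-/
theorem hasBallBound_of_restrictSpheres {n m : ℕ} (hn : 0 < n)
    {Ω : (Fin m → EuclideanSpace ℝ (Fin n)) → ℂ}
    (hhom : ∀ t : Fin m → ℝ, (∀ i, 0 < t i) → ∀ y, Ω (fun i => t i • y i) = Ω y) {s : ℝ≥0∞}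
    (hΩ : AEStronglyMeasurable (restrictSpheres Ω) (spheresMeasure n m)) :
    HasBallBound Ω s (((n : ℝ≥0∞)⁻¹) ^ m) (eLpNorm (restrictSpheres Ω) s (spheresMeasure n m)) := by
  have : Nonempty (Fin n) := ⟨⟨0, hn⟩⟩
  obtain ⟨e⟩ : Nonempty (Metric.sphere (0 : EuclideanSpace ℝ (Fin n)) 1) :=
    (NormedSpace.sphere_nonempty.2 zero_le_one).to_subtype
  set θ : (Fin m → EuclideanSpace ℝ (Fin n)) →
      (Fin m → Metric.sphere (0 : EuclideanSpace ℝ (Fin n)) 1) :=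
    fun y i => sphereProj e (y i) with hθ
  have hθm : Measurable θ := measurable_pi_lambda _ fun i =>
    (measurable_sphereProj e).comp (measurable_pi_apply i)
  refine HasBallBound.of_forall fun R hR => ?_
  set ρ := (volume : Measure (Fin m → EuclideanSpace ℝ (Fin n))).restrict
    (Set.univ.pi fun _ : Fin m => Metric.ball (0 : EuclideanSpace ℝ (Fin n)) R) with hρ
  have hmap : ρ.map θ ≤ (((n : ℝ≥0∞)⁻¹) ^ m * ENNReal.ofReal R ^ (n * m)) •
      spheresMeasure n m := by
    have hfin : IsFiniteMeasure ((volume : Measure (EuclideanSpace ℝ (Fin n))).restrict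
        (Metric.ball 0 R)) := ⟨by simpa using measure_ball_lt_top⟩
    rw [hρ, volume_pi, Measure.restrict_pi_pi, hθ,
      Measure.pi_map_pi fun _ => (measurable_sphereProj e).aemeasurable]
    refine le_of_eq (Measure.pi_eq fun S hS => ?_)
    simp only [map_sphereProj_restrict_ball _ e hR, Measure.smul_apply, smul_eq_mul,
      spheresMeasure, Measure.pi_pi, Finset.prod_mul_distrib, Finset.prod_const,
      Finset.card_univ, Fintype.card_fin, finrank_euclideanSpace]
    rw [← pow_mul]
    ring
  refine eLpNorm_le_of_ae_eq_comp hθm hmap (s := s) hΩ ?_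
  refine ae_restrict_of_ae ?_
  have hne : ∀ᵐ y : Fin m → EuclideanSpace ℝ (Fin n), ∀ i, y i ≠ 0 := by
    rw [ae_all_iff]
    exact fun i => Measure.ae_eval_ne _ i 0
  filter_upwards [hne] with y hy
  rw [← hhom (fun i => ‖y i‖⁻¹) (fun i => inv_pos.2 (norm_pos_iff.2 (hy i))) y]
  simp only [Function.comp, restrictSpheres, hθ, coe_sphereProj e (hy _)]

/-- The product of balls of radius `R` lies in the Euclidean ball of radius `(m+1)R` of `ℝ^{mn}`,
which is projected radially. Measure on the product and on the Euclidean space are compared through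
uniqueness of Haar measure; the scalar `k` is absorbed into `c`. -/
theorem exists_hasBallBound_of_restrictSphere {n m : ℕ} (hn : 0 < n) (hm : 0 < m) :
    ∃ c : ℝ≥0∞, c ≠ ∞ ∧ ∀ (Ω : (Fin m → EuclideanSpace ℝ (Fin n)) → ℂ),
      (∀ t : ℝ, 0 < t → ∀ y, Ω (fun i => t • y i) = Ω y) → ∀ s : ℝ≥0∞,
      AEStronglyMeasurable (restrictSphere Ω) (sphereMeasure n m) →
      HasBallBound Ω s c (eLpNorm (restrictSphere Ω) s (sphereMeasure n m)) := by
  have : Nonempty (Fin n) := ⟨⟨0, hn⟩⟩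
  have : Nonempty (Fin m) := ⟨⟨0, hm⟩⟩
  set W := PiLp 2 (fun _ : Fin m => EuclideanSpace ℝ (Fin n)) with hW
  set L : (Fin m → EuclideanSpace ℝ (Fin n)) ≃L[ℝ] W :=
    (PiLp.continuousLinearEquiv 2 ℝ (fun _ : Fin m => EuclideanSpace ℝ (Fin n))).symm with hL
  have hWn : Nontrivial W := L.symm.toEquiv.nontrivial
  have hdim : Module.finrank ℝ W = n * m := by
    rw [← L.toLinearEquiv.finrank_eq, Module.finrank_pi_fintype]
    simp [mul_comm]
  obtain ⟨e⟩ : Nonempty (Metric.sphere (0 : W) 1) :=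
    (NormedSpace.sphere_nonempty.2 zero_le_one).to_subtype
  have hLm : Measurable L := L.continuous.measurable
  have hHaar : (Measure.map L volume).IsAddHaarMeasure := L.isAddHaarMeasure_map volume
  set k := (Measure.map L volume).addHaarScalarFactor (volume : Measure W) with hk
  have hmapL : Measure.map L volume = k • (volume : Measure W) :=
    Measure.isAddLeftInvariant_eq_smul _ _
  set θ : (Fin m → EuclideanSpace ℝ (Fin n)) → Metric.sphere (0 : W) 1 :=
    fun y => sphereProj e (L y) with hθ
  have hθm : Measurable θ := (measurable_sphereProj e).comp hLm
  set c : ℝ≥0∞ := k * ((m + 1) ^ (n * m) * ((n * m : ℕ) : ℝ≥0∞)⁻¹) with hc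
  have hnm : ((n * m : ℕ) : ℝ≥0∞) ≠ 0 := by exact_mod_cast (Nat.mul_pos hn hm).ne'
  refine ⟨c, ENNReal.mul_ne_top ENNReal.coe_ne_top (ENNReal.mul_ne_top (by finiteness)
    (ENNReal.inv_ne_top.2 hnm)), fun Ω hhom s hΩ => ?_⟩
  refine HasBallBound.of_forall fun R hR => ?_
  set ρ := (volume : Measure (Fin m → EuclideanSpace ℝ (Fin n))).restrict
    (Set.univ.pi fun _ : Fin m => Metric.ball (0 : EuclideanSpace ℝ (Fin n)) R) with hρ
  have hmR : 0 < (m + 1) * R := by positivity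
  have hball : (Set.univ.pi fun _ : Fin m => Metric.ball (0 : EuclideanSpace ℝ (Fin n)) R) ⊆
      L ⁻¹' Metric.ball 0 ((m + 1) * R) := by
    intro y hy
    rw [Set.mem_preimage, mem_ball_zero_iff]
    have h1 : ‖L y‖ ^ 2 ≤ m * R ^ 2 := by
      rw [PiLp.norm_sq_eq_of_L2]
      calc ∑ i, ‖y i‖ ^ 2 ≤ ∑ _i : Fin m, R ^ 2 := by
            refine Finset.sum_le_sum fun i _ => ?_
            gcongr
            exact (mem_ball_zero_iff.1 (hy i (Set.mem_univ i))).le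
        _ = m * R ^ 2 := by simp
    refine lt_of_pow_lt_pow_left₀ 2 (by positivity) (h1.trans_lt ?_)
    have hm0 : (0 : ℝ) ≤ m := by positivity
    rw [mul_pow]
    exact mul_lt_mul_of_pos_right (by nlinarith) (by positivity)
  have hmap : ρ.map θ ≤ (c * ENNReal.ofReal R ^ (n * m)) • sphereMeasure n m := by
    have hsm : sphereMeasure n m = (volume : Measure W).toSphere := rfl
    have h2 : (c * ENNReal.ofReal R ^ (n * m)) • sphereMeasure n m =
        (k : ℝ≥0∞) • ((volume : Measure W).restrict (Metric.ball 0 ((m + 1) * R))).map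
          (sphereProj e) := by
      rw [map_sphereProj_restrict_ball _ e hmR, hdim, smul_smul, hsm]
      congr 1
      rw [ENNReal.ofReal_mul (by positivity), mul_pow, hc,
        ENNReal.ofReal_add (by positivity) (by norm_num)]
      simp only [ENNReal.ofReal_natCast, ENNReal.ofReal_one]
      ring
    rw [h2]
    refine Measure.le_iff.2 fun S hS => ?_
    have hS' := measurable_sphereProj e hS
    rw [Measure.map_apply hθm hS, hρ, Measure.restrict_apply (hθm hS), Measure.smul_apply,
      Measure.map_apply (measurable_sphereProj e) hS, Measure.restrict_apply hS', smul_eq_mul]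
    calc _ ≤ volume (L ⁻¹' (sphereProj e ⁻¹' S ∩ Metric.ball 0 ((m + 1) * R))) :=
          measure_mono fun y hy => ⟨hy.1, hball hy.2⟩
      _ = Measure.map L volume (sphereProj e ⁻¹' S ∩ Metric.ball 0 ((m + 1) * R)) :=
          (Measure.map_apply hLm (hS'.inter Metric.isOpen_ball.measurableSet)).symm
      _ = _ := by rw [hmapL]; rfl
  refine eLpNorm_le_of_ae_eq_comp hθm hmap (s := s) hΩ ?_
  refine ae_restrict_of_ae ?_
  have hne : ∀ᵐ y : Fin m → EuclideanSpace ℝ (Fin n), y ≠ 0 := by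
    filter_upwards [Measure.ae_eval_ne (μ := fun _ : Fin m =>
      (volume : Measure (EuclideanSpace ℝ (Fin n)))) ⟨0, hm⟩ 0] with y hy h
    exact hy (by rw [h]; rfl)
  filter_upwards [hne] with y hy
  have hLy : L y ≠ 0 := by simpa using hy
  rw [← hhom (‖L y‖⁻¹) (inv_pos.2 (norm_pos_iff.2 hLy)) y]
  simp only [Function.comp, restrictSphere, hθ, coe_sphereProj e hLy]
  rfl

/-! ### The two homogeneity conditions combined. -/

theorem theorem1p8 (n m : ℕ) (hn : 0 < n) (hm : 0 < m)
    (s : ℝ≥0∞) (s' : ℝ) (hs' : 1 ≤ s') (hs : s.HolderConjugate (ENNReal.ofReal s'))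
    (P : Fin m → ℝ) (hP : ∀ i, s' < P i) (p : ℝ) (hp : 1 / p = ∑ i, 1 / P i) :
    ∃ C : ℝ≥0,
      ∀ (ω : Fin m → EuclideanSpace ℝ (Fin n) → ℝ≥0)
        (f : Fin m → EuclideanSpace ℝ (Fin n) → ℂ)
        (Ω : (Fin m → EuclideanSpace ℝ (Fin n)) → ℂ),
        (∀ i, AEMeasurable (ω i) volume) →
        (∀ i, AEStronglyMeasurable (f i) volume) →
        apConst (p / s') (fun i => P i / s') ω < ∞ →
        ((∀ t : ℝ, 0 < t → ∀ y, Ω (fun i => t • y i) = Ω y) →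
          MemLp (restrictSphere Ω) s (sphereMeasure n m) →
          weightedNorm (roughMaximal Ω f) p (jointWeight p P ω) ≤
            C * eLpNorm (restrictSphere Ω) s (sphereMeasure n m) *
              apConst (p / s') (fun i => P i / s') ω ^ (1 / p) *
              (∏ i, aInftyConst (dualWeight (P i / s') (ω i)) ^ (1 / P i)) *
              ∏ i, weightedNorm (f i) (P i) (fun x => (ω i x : ℝ≥0∞))) ∧
        ((∀ t : Fin m → ℝ, (∀ i, 0 < t i) → ∀ y, Ω (fun i => t i • y i) = Ω y) →
          MemLp (restrictSpheres Ω) s (spheresMeasure n m) →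
          weightedNorm (roughMaximal Ω f) p (jointWeight p P ω) ≤
            C * eLpNorm (restrictSpheres Ω) s (spheresMeasure n m) *
              apConst (p / s') (fun i => P i / s') ω ^ (1 / p) *
              (∏ i, aInftyConst (dualWeight (P i / s') (ω i)) ^ (1 / P i)) *
              ∏ i, weightedNorm (f i) (P i) (fun x => (ω i x : ℝ≥0∞))) := by
  obtain ⟨c, hc, hcΩ⟩ := exists_hasBallBound_of_restrictSphere hn hm
  obtain ⟨C₁, hC₁⟩ := exists_weightedNorm_roughMaximal_le n hm s hs' hs hP hp hc
  have hn' : (n : ℝ≥0∞)⁻¹ ≠ ∞ := ENNReal.inv_ne_top.2 (by exact_mod_cast hn.ne')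
  obtain ⟨C₂, hC₂⟩ := exists_weightedNorm_roughMaximal_le n hm s hs' hs hP hp
    (c := ((n : ℝ≥0∞)⁻¹) ^ m) (ENNReal.pow_ne_top hn')
  refine ⟨max C₁ C₂, fun ω f Ω hω hf hap => ⟨fun hhom hΩ => ?_, fun hhom hΩ => ?_⟩⟩
  · refine (hC₁ ω f Ω _ (hcΩ Ω hhom s hΩ.1) hω hf hap).trans ?_
    gcongr
    exact le_max_left _ _
  · refine (hC₂ ω f Ω _ (hasBallBound_of_restrictSpheres hn hhom hΩ.1) hω hf hap).trans ?_
    gcongr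
    exact le_max_right _ _
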